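/- Let $\mathbb T_n$ be the rooted binary tree of depth $n\ge 0$, with $2^{n+1}-1$ vertices (root and leaves included). Each vertex carries a gate, which is in state OR ($=1$) or AND ($=0$). Each leaf (a vertex at level $n$) receives the two in-signals $0$ and $1$; every other vertex receives as in-signals the out-signals of its two children; the out-signal of a vertex is the OR, respectively the AND, of its two in-signals according to the state of its gate. Let $f_n(x)\in\{0,1\}$ be the out-signal at the root when the gates are in the states $x\in\{0,1\}^{\mathbb T_n}$. Let $X^{(n)}(t)=(X^{(n)}_v(t))_{v\in\mathbb T_n}$, $t\ge 0$, where the $X^{(n)}_v$ are independent stationary continuous-time Markov chains on $\{0,1\}$, with right-continuous paths, that jump from $0$ to $1$ and from $1$ to $0$ with rate $1/2$ (equivalently, each gate is updated at rate $1$ and at each update it is AND or OR with probability $1/2$ each, independently of everything else). Let $C_n$ be the number of times that $f_n(X^{(n)}(t))$ changes its state during $t\in[0,1]$. **Theorem.** The sequence $(f_n)$ is Type 2 semi-volatile with respect to $p\equiv 1/2$, that is, $$\liminf_{n\to\infty}\mathbb P(C_n=0)>0,\qquad \lim_{M\to\infty}\liminf_{n\to\infty}\mathbb P(C_n>M)>0,$$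 and there is a $k\ge 1$ such that $$\limsup_{n\to\infty}\mathbb P(1\le C_n\le k)>0.$$ Moreover there is a $\delta>0$ such that $\delta\le\mathbb P\big(f_n(X^{(n)}(t))=1\text{ for all }t\in[0,1]\big)\le 1-\delta$ for all $n$. -/

import Mathlib

open MeasureTheory ProbabilityTheory Filter Topology
open scoped NNReal ENNReal

/-! ### Stationary two-state Markov dynamics on a family of bits -/

/-- The Bernoulli weight of a state: `1` (`true`) has weight `p`, `0` (`false`) has `1 - p`. -/
def bernoulliWeight (p : ℝ) : Bool → ℝ
  | true => p
  | false => 1 - p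

/-- The generator of the chain on `{0,1}` jumping from `0` to `1` with rate `p` and from `1` to `0`
with rate `1 - p`. -/
def bitGenerator (p : ℝ) (x y : Bool) : ℝ :=
  if x = y then -bernoulliWeight p (!x) else bernoulliWeight p y

/-- The transition function of that chain: with probability `exp (-t)` there is no update during a
time interval of length `t`; otherwise the state has been resampled from the Bernoulli weights. -/
noncomputable def bitTransition (p t : ℝ) (x y : Bool) : ℝ :=
  Real.exp (-t) * (if x = y then 1 else 0) + (1 - Real.exp (-t)) * bernoulliWeight p y

theorem bitTransition_zero (p : ℝ) (x y : Bool) :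
    bitTransition p 0 x y = if x = y then 1 else 0 := by
  simp [bitTransition]

/-- Kolmogorov's forward equation: the transition function is the one generated by the jump
rates. -/
theorem hasDerivAt_bitTransition (p t : ℝ) (x y : Bool) :
    HasDerivAt (fun s => bitTransition p s x y)
      (∑ z, bitTransition p t x z * bitGenerator p z y) t := by
  have h : HasDerivAt (fun s : ℝ => Real.exp (-s)) (-Real.exp (-t)) t := by
    simpa using (hasDerivAt_neg t).exp
  have h2 := (h.mul_const (if x = y then (1 : ℝ) else 0)).add
    ((h.const_sub 1).mul_const (bernoulliWeight p y))
  refine h2.congr_deriv ?_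
  cases x <;> cases y <;> simp [bitTransition, bitGenerator, bernoulliWeight] <;> ring

/-- `X i t ω` is the state of bit `i` at time `t`. The bits are independent stationary
continuous-time Markov chains on `{0,1}` that jump from `0` to `1` with rate `p` and from `1` to
`0` with rate `1 - p`, with right-continuous paths (almost surely). -/
structure IsBitDynamics {ι Ω : Type*} [MeasurableSpace Ω] (p : ℝ) (μ : Measure Ω)
    (X : ι → ℝ≥0 → Ω → Bool) : Prop where
  measurable : ∀ i t, Measurable (X i t)
  rightContinuous : ∀ᵐ ω ∂μ, ∀ i t, ContinuousWithinAt (fun s => X i s ω) (Set.Ici t) t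
  /-- Different bits have independent trajectories. -/
  indep : iIndepFun (fun (i : ι) (ω : Ω) (t : ℝ≥0) => X i t ω) μ
  /-- Finite-dimensional distributions of the chain started from its stationary law. -/
  law : ∀ (i : ι) (t : ℕ → ℝ≥0), Monotone t → ∀ (x : ℕ → Bool) (k : ℕ),
    μ {ω | ∀ j ≤ k, X i (t j) ω = x j} =
      ENNReal.ofReal (bernoulliWeight p (x 0) *
        ∏ j ∈ Finset.range k, bitTransition p ((t (j + 1) : ℝ) - t j) (x j) (x (j + 1)))

/-! ### Counting state changes, semi-volatility -/

/-- The number of times (possibly `⊤`) at which a `{0,1}`-valued path changes its state during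
`[a, b]`, that is, the number of its discontinuities in `[a, b]`. -/
noncomputable def numChanges (g : ℝ≥0 → Bool) (a b : ℝ≥0) : ℕ∞ :=
  {t ∈ Set.Icc a b | ¬ ContinuousWithinAt g (Set.Icc a b) t}.encard

/-- The number of state changes of `f (X(t))` during `[0, 1]`. -/
noncomputable def changeCount {ι Ω : Type*} (f : (ι → Bool) → Bool) (X : ι → ℝ≥0 → Ω → Bool)
    (ω : Ω) : ℕ∞ :=
  numChanges (fun t => f (fun i => X i t ω)) 0 1

/-- Semi-volatility of a sequence of counts `C n` defined on probability spaces `(Ω n, μ n)`: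
`liminf_n P(C n = 0) > 0` and `lim_{M → ∞} liminf_n P(C n > M) > 0`. -/
def IsSemiVolatile {Ω : ℕ → Type*} [∀ n, MeasurableSpace (Ω n)] (μ : ∀ n, Measure (Ω n))
    (C : ∀ n, Ω n → ℕ∞) : Prop :=
  0 < liminf (fun n => μ n {ω | C n ω = 0}) atTop ∧
  ∃ L : ℝ≥0∞, 0 < L ∧
    Tendsto (fun M : ℕ => liminf (fun n => μ n {ω | (M : ℕ∞) < C n ω}) atTop) atTop (𝓝 L)

/-- Type 2 semi-volatility: semi-volatile and, for some `k ≥ 1`,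
`limsup_n P(1 ≤ C n ≤ k) > 0`. -/
def IsType2SemiVolatile {Ω : ℕ → Type*} [∀ n, MeasurableSpace (Ω n)] (μ : ∀ n, Measure (Ω n))
    (C : ∀ n, Ω n → ℕ∞) : Prop :=
  IsSemiVolatile μ C ∧
  ∃ k : ℕ, 1 ≤ k ∧ 0 < limsup (fun n => μ n {ω | 1 ≤ C n ω ∧ C n ω ≤ (k : ℕ∞)}) atTop

/-! ### The AND/OR function on the binary tree -/

/-- The vertices of the rooted binary tree of depth `n`: the root and, if the depth is positive,
the vertices of the left and of the right subtree of the root, which have depth one less. -/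
inductive TreeVertex : ℕ → Type
  | root {n : ℕ} : TreeVertex n
  | left {n : ℕ} : TreeVertex n → TreeVertex (n + 1)
  | right {n : ℕ} : TreeVertex n → TreeVertex (n + 1)

/-- The out-signal of a gate in state `g` (`true` is OR, `false` is AND) with in-signals
`a`, `b`. -/
def gateOutput (g a b : Bool) : Bool :=
  if g then a || b else a && b

/-- The out-signal at the root of the binary tree of depth `n` when the gate at vertex `v` is in
state `x v`: each leaf has the in-signals `0` and `1`, and any other vertex has the out-signals of
its two children as in-signals. -/
def andOr : (n : ℕ) → (TreeVertex n → Bool) → Bool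
  | 0, x => gateOutput (x .root) false true
  | n + 1, x => gateOutput (x .root) (andOr n fun v => x v.left) (andOr n fun v => x v.right)

/-! ### The path law of a single bit -/

/-! Only the law of the out-signal path matters, and it obeys a recursion in the depth: a gate path
and two independent copies of the previous law are fed into `gatePath`. This law is invariant under
exchanging 0 and 1 (De Morgan) and under time shifts. With p = 1/2 a gate is neutral to first order,
so second-order effects decide.

Staying constant. Let a(T) be the probability of being 1 along a grid of length T. Changes of the
gate raise the defect 1 - 2a(T) by order T at every level. Under a constant OR gate, however, one
child may be 1 on the first half of the interval and the other on the second half; this relay gains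
order (a(T/2) - a(T))². A defect c√T is self-consistent: c√T and c√(T/2) differ by order √T, so the
gain is of order T and, for c large, beats the loss (`one_sub_le_sqrt_of_relay`). This settles short
intervals; relaying again doubles the length at the price of a constant factor, uniformly in the
depth.

Changing often. If γ is the probability that a gate differs at two times, the probability η of a
differing out-signal evolves roughly as η - η²/2 + γ/2 and settles at order √γ, so N grid steps see
about √N changes on average. When the signal changes on two steps at distance r, up to errors of
order 1/N a single child carries both changes and the other lets it through at both times; this has
a total factor at most 1 - η(r), with η(r) of order √r (`measureReal_differAt_inter_succ_le`).
Iterating gives joint probability O(1/(N√r)), hence second moment O(N), the square of the first. So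
more than M changes occur with a probability bounded below independently of M.

Changing a few times. If one child is constantly 1 and the other constantly 0, the out-signal is the
root gate itself, which changes once or twice with positive probability.

Events are formulated on countably many times, to be measurable for the product σ-algebra;
right-continuity carries them over to all of [0,1]. -/

theorem bernoulliWeight_half (x : Bool) : bernoulliWeight (1 / 2) x = 1 / 2 := by
  cases x <;> norm_num [bernoulliWeight]

/-- `W` is the law of the trajectory of one stationary bit with `p = 1/2`. -/
structure IsChainLaw (W : Measure (ℝ≥0 → Bool)) : Prop where
  isProb : IsProbabilityMeasure W
  law : ∀ t : ℕ → ℝ≥0, Monotone t → ∀ (x : ℕ → Bool) (k : ℕ),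
    W {w | ∀ j ≤ k, w (t j) = x j} =
      ENNReal.ofReal (1 / 2 *
        ∏ j ∈ Finset.range k, bitTransition (1 / 2) ((t (j + 1) : ℝ) - t j) (x j) (x (j + 1)))

theorem measurableSet_cylinder_le (t : ℕ → ℝ≥0) (x : ℕ → Bool) (k : ℕ) :
    MeasurableSet {w : ℝ≥0 → Bool | ∀ j ≤ k, w (t j) = x j} := by
  have : {w : ℝ≥0 → Bool | ∀ j ≤ k, w (t j) = x j}
      = ⋂ j ∈ Set.Iic k, (fun w : ℝ≥0 → Bool => w (t j)) ⁻¹' {x j} := by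
    ext w; simp
  rw [this]
  exact MeasurableSet.biInter (Set.to_countable _)
    fun j _ => measurable_pi_apply (t j) (measurableSet_singleton _)

/-- A nonempty finite set of times can be listed as an eventually constant monotone sequence. -/
theorem exists_monotone_enumeration (I : Finset ℝ≥0) (hI : I.Nonempty) :
    ∃ (t : ℕ → ℝ≥0) (k : ℕ), Monotone t ∧ (∀ j, t j ∈ I) ∧ ∀ s ∈ I, ∃ j ≤ k, t j = s := by
  have hc : 0 < I.card := hI.card_pos
  refine ⟨fun j => I.orderEmbOfFin rfl ⟨min j (I.card - 1), by omega⟩, I.card - 1, ?_, ?_, ?_⟩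
  · intro i j hij
    apply (I.orderEmbOfFin rfl).monotone
    simp only [Fin.mk_le_mk]
    omega
  · intro j
    exact I.orderEmbOfFin_mem rfl _
  · intro s hs
    have : s ∈ Set.range (I.orderEmbOfFin rfl) := by
      rw [Finset.range_orderEmbOfFin]; exact hs
    obtain ⟨i, rfl⟩ := this
    have hi := i.isLt
    refine ⟨i, by omega, ?_⟩
    exact congrArg _ (Fin.ext (min_eq_left (by omega)))

/-- Listing a finite set of times in increasing order shows that all finite marginals agree, and
projective limits of finite measures are unique. This turns symmetries of the transition function
into symmetries of the law, and identifies gates living on different probability spaces. -/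
theorem IsChainLaw.unique {W W' : Measure (ℝ≥0 → Bool)} (h : IsChainLaw W) (h' : IsChainLaw W') :
    W = W' := by
  have := h.isProb
  have := h'.isProb
  have key : ∀ I : Finset ℝ≥0, W'.map I.restrict = W.map I.restrict := by
    intro I
    apply Measure.ext_of_singleton
    intro y
    rw [Measure.map_apply (by fun_prop) (measurableSet_singleton _),
      Measure.map_apply (by fun_prop) (measurableSet_singleton _)]
    rcases I.eq_empty_or_nonempty with rfl | hI
    · have : (Finset.restrict (∅ : Finset ℝ≥0) (π := fun _ => Bool)) ⁻¹' {y} = Set.univ := by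
        ext w
        simp only [Set.mem_preimage, Set.mem_singleton_iff, Set.mem_univ, iff_true]
        exact Subsingleton.elim _ _
      rw [this, measure_univ, measure_univ]
    · obtain ⟨t, k, hmono, hmem, hsurj⟩ := exists_monotone_enumeration I hI
      have : (Finset.restrict I (π := fun _ => Bool)) ⁻¹' {y}
          = {w | ∀ j ≤ k, w (t j) = y ⟨t j, hmem j⟩} := by
        ext w
        simp only [Set.mem_preimage, Set.mem_singleton_iff, Set.mem_ofPred_eq]
        constructor
        · rintro rfl j _
          rfl
        · intro hw
          funext ⟨s, hs⟩
          obtain ⟨j, hj, rfl⟩ := hsurj s hs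
          exact hw j hj
      rw [this, h.law t hmono (fun j => y ⟨t j, hmem j⟩) k,
        h'.law t hmono (fun j => y ⟨t j, hmem j⟩) k]
  have hW : IsProjectiveLimit W (fun I : Finset ℝ≥0 => W.map I.restrict) := fun I => rfl
  have hW' : IsProjectiveLimit W' (fun I : Finset ℝ≥0 => W.map I.restrict) := fun I => key I
  have : ∀ I : Finset ℝ≥0, IsFiniteMeasure (W.map (Finset.restrict I (π := fun _ => Bool))) :=
    fun I => inferInstance
  exact hW.unique hW'

theorem measurable_path {ι Ω : Type*} [MeasurableSpace Ω] {p : ℝ} {μ : Measure Ω}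
    {X : ι → ℝ≥0 → Ω → Bool} (hX : IsBitDynamics p μ X) (i : ι) :
    Measurable (fun ω t => X i t ω) :=
  measurable_pi_lambda _ fun t => hX.measurable i t

theorem IsBitDynamics.isChainLaw {ι Ω : Type*} [MeasurableSpace Ω] {μ : Measure Ω}
    [IsProbabilityMeasure μ] {X : ι → ℝ≥0 → Ω → Bool} (hX : IsBitDynamics (1 / 2) μ X) (i : ι) :
    IsChainLaw (μ.map fun ω t => X i t ω) where
  isProb := Measure.isProbabilityMeasure_map (measurable_path hX i).aemeasurable
  law t ht x k := by
    rw [Measure.map_apply (measurable_path hX i) (measurableSet_cylinder_le t x k)]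
    have := hX.law i t ht x k
    rw [bernoulliWeight_half] at this
    exact this

/-- The path with all bits flipped. -/
def flipPath (w : ℝ≥0 → Bool) : ℝ≥0 → Bool := fun t => !(w t)

/-- The path started at time `s`. -/
def shiftPath (s : ℝ≥0) (w : ℝ≥0 → Bool) : ℝ≥0 → Bool := fun t => w (t + s)

theorem measurable_flipPath : Measurable flipPath :=
  measurable_pi_lambda _ fun t => (measurable_of_countable (fun b : Bool => !b)).comp
    (measurable_pi_apply t)

theorem measurable_shiftPath (s : ℝ≥0) : Measurable (shiftPath s) :=
  measurable_pi_lambda _ fun t => measurable_pi_apply (t + s)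

theorem bitTransition_half_not (t : ℝ) (x y : Bool) :
    bitTransition (1 / 2) t (!x) (!y) = bitTransition (1 / 2) t x y := by
  simp only [bitTransition, bernoulliWeight_half, Bool.not_inj_iff]

theorem IsChainLaw.map_flipPath {W : Measure (ℝ≥0 → Bool)} (h : IsChainLaw W) :
    W.map flipPath = W := by
  have := h.isProb
  refine IsChainLaw.unique
    ⟨Measure.isProbabilityMeasure_map measurable_flipPath.aemeasurable, ?_⟩ h
  intro t ht x k
  rw [Measure.map_apply measurable_flipPath (measurableSet_cylinder_le t x k)]
  have h1 := h.law t ht (fun j => !(x j)) k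
  simp only [bitTransition_half_not] at h1
  rw [← h1]
  congr 1
  ext w
  simp only [Set.mem_preimage, Set.mem_ofPred_eq, flipPath, Bool.not_eq_eq_eq_not]

theorem IsChainLaw.map_shiftPath {W : Measure (ℝ≥0 → Bool)} (h : IsChainLaw W) (s : ℝ≥0) :
    W.map (shiftPath s) = W := by
  have := h.isProb
  refine IsChainLaw.unique
    ⟨Measure.isProbabilityMeasure_map (measurable_shiftPath s).aemeasurable, ?_⟩ h
  intro t ht x k
  rw [Measure.map_apply (measurable_shiftPath s) (measurableSet_cylinder_le t x k)]
  have h1 := h.law (fun j => t j + s) (fun i j hij => by simpa using ht hij) x k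
  simp only [NNReal.coe_add, add_sub_add_right_eq_sub] at h1
  exact h1

/-! ### The path law of the out-signal -/

/-- The out-signal path of a gate, given the paths of its state and of its in-signals. -/
def gatePath (q : (ℝ≥0 → Bool) × (ℝ≥0 → Bool) × (ℝ≥0 → Bool)) : ℝ≥0 → Bool :=
  fun t => gateOutput (q.1 t) (q.2.1 t) (q.2.2 t)

theorem measurable_gateOutput :
    Measurable fun q : Bool × Bool × Bool => gateOutput q.1 q.2.1 q.2.2 :=
  measurable_of_countable _

theorem measurable_gatePath : Measurable gatePath := by
  refine measurable_pi_lambda _ fun t => measurable_gateOutput.comp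
    (Measurable.prodMk ?_ (Measurable.prodMk ?_ ?_))
  · exact (measurable_pi_apply t).comp measurable_fst
  · exact (measurable_pi_apply t).comp (measurable_fst.comp measurable_snd)
  · exact (measurable_pi_apply t).comp (measurable_snd.comp measurable_snd)

/-- The law of the out-signal path at the root of the tree of depth `n`, when `W` is the path law of
a gate state. -/
noncomputable def outputLaw (W : Measure (ℝ≥0 → Bool)) : ℕ → Measure (ℝ≥0 → Bool)
  | 0 => W
  | n + 1 => (W.prod ((outputLaw W n).prod (outputLaw W n))).map gatePath

theorem isProbabilityMeasure_outputLaw (W : Measure (ℝ≥0 → Bool)) [IsProbabilityMeasure W] (n : ℕ) :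
    IsProbabilityMeasure (outputLaw W n) := by
  induction n with
  | zero => assumption
  | succ n ih => exact Measure.isProbabilityMeasure_map measurable_gatePath.aemeasurable

/-- De Morgan duality, the source of the 0-1 symmetry of the out-signal. -/
theorem gateOutput_not (g a b : Bool) : gateOutput (!g) (!a) (!b) = !gateOutput g a b := by
  cases g <;> cases a <;> cases b <;> rfl

theorem gateOutput_leaf (g : Bool) : gateOutput g false true = g := by
  cases g <;> rfl

/-- A map acting on paths that commutes with the gates and preserves the law of the gate states
preserves the law of the out-signal. -/
theorem map_outputLaw {W : Measure (ℝ≥0 → Bool)} [IsProbabilityMeasure W]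
    {φ : (ℝ≥0 → Bool) → (ℝ≥0 → Bool)} (hφ : Measurable φ) (hW : W.map φ = W)
    (hgate : ∀ g a b, φ (gatePath (g, a, b)) = gatePath (φ g, φ a, φ b)) (n : ℕ) :
    (outputLaw W n).map φ = outputLaw W n := by
  induction n with
  | zero => exact hW
  | succ n ih =>
    have := isProbabilityMeasure_outputLaw W n
    have h1 : (W.prod ((outputLaw W n).prod (outputLaw W n))).map (Prod.map φ (Prod.map φ φ))
        = W.prod ((outputLaw W n).prod (outputLaw W n)) := by
      rw [← Measure.map_prod_map _ _ hφ (hφ.prodMap hφ), ← Measure.map_prod_map _ _ hφ hφ, hW, ih]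
    have h2 : φ ∘ gatePath = gatePath ∘ Prod.map φ (Prod.map φ φ) := by
      funext ⟨g, a, b⟩
      exact hgate g a b
    rw [outputLaw, Measure.map_map hφ measurable_gatePath, h2,
      ← Measure.map_map measurable_gatePath (hφ.prodMap (hφ.prodMap hφ)), h1]

theorem map_flipPath_outputLaw {W : Measure (ℝ≥0 → Bool)} (h : IsChainLaw W) (n : ℕ) :
    (outputLaw W n).map flipPath = outputLaw W n :=
  have := h.isProb
  map_outputLaw measurable_flipPath h.map_flipPath
    (fun g a b => by funext t; simp only [flipPath, gatePath, gateOutput_not]) n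

theorem map_shiftPath_outputLaw {W : Measure (ℝ≥0 → Bool)} (h : IsChainLaw W) (s : ℝ≥0) (n : ℕ) :
    (outputLaw W n).map (shiftPath s) = outputLaw W n :=
  have := h.isProb
  map_outputLaw (measurable_shiftPath s) (h.map_shiftPath s)
    (fun g a b => by funext t; simp only [shiftPath, gatePath]) n

/-! ### The out-signal of the dynamical tree -/

/-- The σ-algebra is a variable argument: independence of the two subtrees needs measurability with
respect to the σ-algebra of each block of bits. -/
theorem measurable_andOr_path {Ω : Type*} {m : MeasurableSpace Ω} (n : ℕ)
    (X : TreeVertex n → ℝ≥0 → Ω → Bool) (hX : ∀ v, Measurable fun ω t => X v t ω) :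
    Measurable (fun ω t => andOr n fun v => X v t ω) := by
  induction n with
  | zero =>
    have h : (fun ω t => andOr 0 fun v => X v t ω) = fun ω t => X .root t ω := by
      funext ω t
      exact gateOutput_leaf _
    rw [h]
    exact hX _
  | succ n ih =>
    exact measurable_gatePath.comp ((hX .root).prodMk
      ((ih (fun v => X v.left) fun v => hX _).prodMk (ih (fun v => X v.right) fun v => hX _)))

theorem IsBitDynamics.precomp {ι κ Ω : Type*} [MeasurableSpace Ω] {p : ℝ} {μ : Measure Ω}
    {X : ι → ℝ≥0 → Ω → Bool} (hX : IsBitDynamics p μ X) {e : κ → ι} (he : e.Injective) :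
    IsBitDynamics p μ (fun v => X (e v)) where
  measurable i := hX.measurable (e i)
  rightContinuous := hX.rightContinuous.mono fun _ h i => h (e i)
  indep := hX.indep.precomp he
  law i := hX.law (e i)

/-- Functions of disjoint blocks of bits are independent. -/
theorem IsBitDynamics.indepFun {ι Ω α β : Type*} [MeasurableSpace Ω] [mα : MeasurableSpace α]
    [mβ : MeasurableSpace β] {p : ℝ} {μ : Measure Ω} {X : ι → ℝ≥0 → Ω → Bool}
    (hX : IsBitDynamics p μ X) {S T : Set ι} (hST : Disjoint S T) {f : Ω → α} {g : Ω → β}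
    (hf : ∀ m : MeasurableSpace Ω, (∀ v ∈ S, Measurable[m] fun ω t => X v t ω) → Measurable[m] f)
    (hg : ∀ m : MeasurableSpace Ω, (∀ v ∈ T, Measurable[m] fun ω t => X v t ω) → Measurable[m] g) :
    IndepFun f g μ := by
  have hind := hX.indep
  rw [iIndepFun_iff_iIndep] at hind
  have h := indep_iSup_of_disjoint (fun i => (measurable_path hX i).comap_le) hind hST
  rw [IndepFun_iff_Indep]
  refine indep_of_indep_of_le_left (indep_of_indep_of_le_right h ?_) ?_
  · refine (hg _ fun v hv => ?_).comap_le
    exact (comap_measurable _).mono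
      (le_iSup₂_of_le (f := fun i (_ : i ∈ T) =>
        MeasurableSpace.comap (fun ω t => X i t ω) MeasurableSpace.pi) v hv le_rfl) le_rfl
  · refine (hf _ fun v hv => ?_).comap_le
    exact (comap_measurable _).mono
      (le_iSup₂_of_le (f := fun i (_ : i ∈ S) =>
        MeasurableSpace.comap (fun ω t => X i t ω) MeasurableSpace.pi) v hv le_rfl) le_rfl

/-- The joint law of the gate state at the root and of the out-signals of its two children. -/
theorem IsBitDynamics.map_root_left_right {Ω : Type*} [MeasurableSpace Ω] {μ : Measure Ω}
    [IsProbabilityMeasure μ] {n : ℕ} {X : TreeVertex (n + 1) → ℝ≥0 → Ω → Bool}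
    (hX : IsBitDynamics (1 / 2) μ X) :
    μ.map (fun ω => ((fun t => X .root t ω : ℝ≥0 → Bool),
        (fun t => andOr n fun v => X v.left t ω : ℝ≥0 → Bool),
        (fun t => andOr n fun v => X v.right t ω : ℝ≥0 → Bool))) =
      (μ.map fun ω t => X .root t ω).prod
        ((μ.map fun ω t => andOr n fun v => X v.left t ω).prod
          (μ.map fun ω t => andOr n fun v => X v.right t ω)) := by
  have hl := measurable_andOr_path n (fun v => X v.left) fun v => measurable_path hX _
  have hr := measurable_andOr_path n (fun v => X v.right) fun v => measurable_path hX _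
  have h1 : IndepFun (fun ω t => andOr n fun v => X v.left t ω)
      (fun ω t => andOr n fun v => X v.right t ω) μ := by
    refine hX.indepFun (S := Set.range .left) (T := Set.range .right) ?_
      (fun m h => measurable_andOr_path n _ fun v => h _ ⟨v, rfl⟩)
      (fun m h => measurable_andOr_path n _ fun v => h _ ⟨v, rfl⟩)
    rw [Set.disjoint_left]
    rintro _ ⟨v, rfl⟩ ⟨w, hw⟩
    cases hw
  have h2 : IndepFun (fun ω t => X .root t ω)
      (fun ω => ((fun t => andOr n fun v => X v.left t ω : ℝ≥0 → Bool),
        (fun t => andOr n fun v => X v.right t ω : ℝ≥0 → Bool))) μ := by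
    refine hX.indepFun (S := {.root}) (T := {.root}ᶜ) disjoint_compl_right
      (fun m h => h _ rfl) (fun m h => Measurable.prodMk
        (measurable_andOr_path n _ fun v => h _ (by simp))
        (measurable_andOr_path n _ fun v => h _ (by simp)))
  rw [h2.map_prod_eq_prod_map_map (measurable_path hX _).aemeasurable (hl.prodMk hr).aemeasurable,
    h1.map_prod_eq_prod_map_map hl.aemeasurable hr.aemeasurable]

/-- The root gate and the two subtrees are independent blocks, which is the recursion defining
`outputLaw`. Afterwards estimates can be made for `outputLaw` alone. -/
theorem IsBitDynamics.map_andOr {Ω : Type*} [MeasurableSpace Ω] {μ : Measure Ω}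
    [IsProbabilityMeasure μ] {W : Measure (ℝ≥0 → Bool)} (hW : IsChainLaw W) {n : ℕ}
    {X : TreeVertex n → ℝ≥0 → Ω → Bool} (hX : IsBitDynamics (1 / 2) μ X) :
    μ.map (fun ω t => andOr n fun v => X v t ω) = outputLaw W n := by
  induction n with
  | zero =>
    have h : (fun ω t => andOr 0 fun v => X v t ω) = fun ω t => X .root t ω := by
      funext ω t
      exact gateOutput_leaf _
    rw [h]
    exact (hX.isChainLaw _).unique hW
  | succ n ih =>
    have hl := measurable_andOr_path n (fun v => X v.left) fun v => measurable_path hX _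
    have hr := measurable_andOr_path n (fun v => X v.right) fun v => measurable_path hX _
    have h := hX.map_root_left_right
    rw [ih (hX.precomp (e := .left) fun a b h => by cases h; rfl),
      ih (hX.precomp (e := .right) fun a b h => by cases h; rfl),
      (hX.isChainLaw _).unique hW] at h
    rw [outputLaw, ← h, Measure.map_map measurable_gatePath
      ((measurable_path hX _).prodMk (hl.prodMk hr))]
    rfl

theorem IsBitDynamics.map_root_left_right_eq {Ω : Type*} [MeasurableSpace Ω] {μ : Measure Ω}
    [IsProbabilityMeasure μ] {W : Measure (ℝ≥0 → Bool)} (hW : IsChainLaw W) {n : ℕ}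
    {X : TreeVertex (n + 1) → ℝ≥0 → Ω → Bool} (hX : IsBitDynamics (1 / 2) μ X) :
    μ.map (fun ω => ((fun t => X .root t ω : ℝ≥0 → Bool),
        (fun t => andOr n fun v => X v.left t ω : ℝ≥0 → Bool),
        (fun t => andOr n fun v => X v.right t ω : ℝ≥0 → Bool))) =
      W.prod ((outputLaw W n).prod (outputLaw W n)) := by
  rw [hX.map_root_left_right,
    (hX.precomp (e := .left) fun a b h => by cases h; rfl).map_andOr hW,
    (hX.precomp (e := .right) fun a b h => by cases h; rfl).map_andOr hW,
    (hX.isChainLaw _).unique hW]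

/-! ### Right-continuous paths and their changes along grids -/

/-- The indices `i < N` such that the path changes between `i / N` and `(i + 1) / N`. -/
noncomputable def changeIndices (N : ℕ) (x : ℝ≥0 → Bool) : Finset ℕ :=
  {i ∈ Finset.range N | x (i / N) ≠ x ((i + 1 : ℕ) / N)}

theorem mem_changeIndices {N i : ℕ} {x : ℝ≥0 → Bool} :
    i ∈ changeIndices N x ↔ i < N ∧ x (i / N) ≠ x ((i + 1 : ℕ) / N) := by
  simp [changeIndices]

/-- A continuous map from an interval to a discrete space is constant. Right-continuity at `s`
removes the left endpoint, so adjacent grid cells yield distinct discontinuities. -/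
theorem exists_discontinuity_Ioc {x : ℝ≥0 → Bool}
    (hx : ∀ t, ContinuousWithinAt x (Set.Ici t) t) {a b s u : ℝ≥0} (has : a ≤ s) (hsu : s ≤ u)
    (hub : u ≤ b) (hne : x s ≠ x u) :
    ∃ t ∈ Set.Ioc s u, ¬ ContinuousWithinAt x (Set.Icc a b) t := by
  by_contra! hcon
  apply hne
  have hc : ContinuousOn x (Set.Icc s u) := by
    intro t ht
    rcases ht.1.eq_or_lt with rfl | hlt
    · exact (hx s).mono Set.Icc_subset_Ici_self
    · exact (hcon t ⟨hlt, ht.2⟩).mono (Set.Icc_subset_Icc has hub)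
  exact isPreconnected_Icc.constant hc (Set.left_mem_Icc.2 hsu) (Set.right_mem_Icc.2 hsu)

theorem card_changeIndices_le_numChanges {x : ℝ≥0 → Bool}
    (hx : ∀ t, ContinuousWithinAt x (Set.Ici t) t) (N : ℕ) :
    ((changeIndices N x).card : ℕ∞) ≤ numChanges x 0 1 := by
  have h : ∀ i ∈ changeIndices N x, ∃ t ∈ Set.Ioc ((i : ℝ≥0) / N) ((i + 1 : ℕ) / N),
      ¬ ContinuousWithinAt x (Set.Icc 0 1) t := by
    intro i hi
    rw [mem_changeIndices] at hi
    refine exists_discontinuity_Ioc hx zero_le ?_ ?_ hi.2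
    · gcongr
      omega
    · refine div_le_one_of_le₀ ?_ zero_le
      exact_mod_cast hi.1
  choose! t ht using h
  have hinj : Set.InjOn t (changeIndices N x) := by
    have key : ∀ i ∈ changeIndices N x, ∀ j ∈ changeIndices N x, i < j → t i < t j := by
      intro i hi j hj hij
      refine (ht i hi).1.2.trans_lt (lt_of_le_of_lt ?_ (ht j hj).1.1)
      gcongr
      omega
    intro i hi j hj hij
    rcases lt_trichotomy i j with h | h | h
    · exact absurd hij (key i hi j hj h).ne
    · exact h
    · exact absurd hij (key j hj i hi h).ne'
  rw [← Set.encard_coe_eq_coe_finsetCard, ← hinj.encard_image]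
  refine Set.encard_le_encard ?_
  rintro _ ⟨i, hi, rfl⟩
  refine ⟨⟨zero_le, (ht i hi).1.2.trans ?_⟩, (ht i hi).2⟩
  refine div_le_one_of_le₀ ?_ zero_le
  exact_mod_cast (mem_changeIndices.1 hi).1

theorem exists_Ico_const {x : ℝ≥0 → Bool} {t : ℝ≥0} (hx : ContinuousWithinAt x (Set.Ici t) t)
    {b : ℝ≥0} (hb : t < b) : ∃ u, t < u ∧ u ≤ b ∧ ∀ s ∈ Set.Ico t u, x s = x t := by
  have h : ∀ᶠ s in 𝓝[≥] t, x s = x t := by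
    have := hx.tendsto
    rwa [nhds_discrete, tendsto_pure] at this
  obtain ⟨u, hu, hsub⟩ := (mem_nhdsGE_iff_exists_Ico_subset' hb).1 h
  exact ⟨min u b, lt_min hu hb, min_le_right _ _,
    fun s hs => hsub ⟨hs.1, hs.2.trans_le (min_le_left _ _)⟩⟩

theorem exists_ne_left_of_discontinuity {x : ℝ≥0 → Bool}
    (hx : ∀ t, ContinuousWithinAt x (Set.Ici t) t) {b t : ℝ≥0}
    (ht : ¬ ContinuousWithinAt x (Set.Icc 0 b) t) :
    0 < t ∧ ∀ l < t, ∃ s ∈ Set.Ioo l t, x s ≠ x t := by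
  refine ⟨?_, ?_⟩
  · rw [pos_iff_ne_zero]
    rintro rfl
    exact ht ((hx 0).mono Set.Icc_subset_Ici_self)
  · intro l hl
    by_contra! hcon
    apply ht
    have h1 : ContinuousWithinAt x (Set.Iic t) t := by
      have : ∀ᶠ s in 𝓝[≤] t, x s = x t := by
        filter_upwards [Ioc_mem_nhdsLE hl] with s hs
        rcases hs.2.eq_or_lt with rfl | h
        · rfl
        · exact hcon s ⟨hs.1, h⟩
      exact tendsto_const_nhds.congr' (this.mono fun s hs => hs.symm)
    have h2 := h1.union (hx t)
    exact h2.mono fun s _ => le_total s t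

theorem exists_change_between {y : ℕ → Bool} {i k : ℕ} (hik : i ≤ k) (h : y i ≠ y k) :
    ∃ j, i ≤ j ∧ j < k ∧ y j ≠ y (j + 1) := by
  by_contra! hcon
  apply h
  have : ∀ j, i ≤ j → j ≤ k → y i = y j := by
    intro j hj
    induction j, hj using Nat.le_induction with
    | base => intro _; rfl
    | succ j hj ih => intro h; rw [ih (by omega), hcon j hj (by omega)]
  exact this k hik le_rfl

/-- By right-continuity, a discontinuity at `t` comes with earlier times `s` arbitrarily close to
`t` having the other value. Both values persist for a while to the right, so a fine grid samples
both near `t`. -/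
theorem exists_changeIndices_near {x : ℝ≥0 → Bool}
    (hx : ∀ t, ContinuousWithinAt x (Set.Ici t) t) {t : ℝ≥0} (ht1 : t ≤ 1)
    (ht : ¬ ContinuousWithinAt x (Set.Icc 0 1) t) {U : Set ℝ≥0} (hU : U ∈ 𝓝 t) :
    ∀ᶠ N : ℕ in atTop, ∃ i ∈ changeIndices N x, (i : ℝ≥0) / N ∈ U := by
  obtain ⟨hpos, hleft⟩ := exists_ne_left_of_discontinuity hx ht
  obtain ⟨l, hl, hlU⟩ := exists_Ioc_subset_of_mem_nhds hU ⟨0, hpos⟩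
  obtain ⟨u, hu, huU⟩ := exists_Ico_subset_of_mem_nhds hU ⟨t + 1, by simp⟩
  obtain ⟨s, hs, hst⟩ := hleft l hl
  obtain ⟨us, hus, -, hsc⟩ := exists_Ico_const (hx s) hs.2
  obtain ⟨ut, hut, hutu, htc⟩ := exists_Ico_const (hx t) hu
  have hlarge : ∀ v w : ℝ≥0, v < w → ∀ᶠ N : ℕ in atTop, v * N + 1 ≤ w * N := by
    intro v w hvw
    obtain ⟨N₀, hN₀⟩ := exists_nat_ge (1 / ((w : ℝ) - v))
    filter_upwards [eventually_ge_atTop N₀] with N hN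
    have hvw' : (0 : ℝ) < w - v := sub_pos.2 (by exact_mod_cast hvw)
    rw [div_le_iff₀ hvw'] at hN₀
    have hN' : (N₀ : ℝ) ≤ N := by exact_mod_cast hN
    have : (v : ℝ) * N + 1 ≤ w * N := by nlinarith
    exact_mod_cast this
  filter_upwards [hlarge s us hus, hlarge t ut hut, eventually_gt_atTop 0] with N h1 h2 hN
  have hN' : (0 : ℝ≥0) < N := by exact_mod_cast hN
  have hgrid : ∀ v w : ℝ≥0, v * N + 1 ≤ w * N →
      v ≤ (⌈v * N⌉₊ : ℝ≥0) / N ∧ (⌈v * N⌉₊ : ℝ≥0) / N < w := by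
    intro v w h
    rw [le_div_iff₀ hN', div_lt_iff₀ hN']
    exact ⟨Nat.le_ceil _, (Nat.ceil_lt_add_one zero_le).trans_le h⟩
  obtain ⟨hs1, hs2⟩ := hgrid s us h1
  obtain ⟨ht1', ht2⟩ := hgrid t ut h2
  have hle : ⌈s * N⌉₊ ≤ ⌈t * N⌉₊ := Nat.ceil_mono (by gcongr; exact hs.2.le)
  have hleN : ⌈t * N⌉₊ ≤ N := Nat.ceil_le.2 (mul_le_of_le_one_left zero_le ht1)
  have hne : x ((⌈s * N⌉₊ : ℕ) / N) ≠ x ((⌈t * N⌉₊ : ℕ) / N) := by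
    rw [hsc _ ⟨hs1, hs2⟩, htc _ ⟨ht1', ht2⟩]
    exact hst
  obtain ⟨j, hj1, hj2, hj⟩ :=
    exists_change_between (y := fun j : ℕ => x ((j : ℝ≥0) / N)) hle hne
  refine ⟨j, mem_changeIndices.2 ⟨by omega, hj⟩, ?_⟩
  have hlo : s ≤ (j : ℝ≥0) / N := hs1.trans (by gcongr)
  have hhi : (j : ℝ≥0) / N < u :=
    lt_of_le_of_lt (by gcongr) (ht2.trans_le hutu)
  rcases le_total ((j : ℝ≥0) / N) t with h | h
  · exact hlU ⟨hs.1.trans_le hlo, h⟩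
  · exact huU ⟨h, hhi⟩

/-- Separate `k + 1` discontinuities by disjoint neighbourhoods; each eventually contains a change
index of its own. -/
theorem eventually_lt_card_changeIndices {x : ℝ≥0 → Bool}
    (hx : ∀ t, ContinuousWithinAt x (Set.Ici t) t) {k : ℕ} (hk : (k : ℕ∞) < numChanges x 0 1) :
    ∀ᶠ N : ℕ in atTop, k < (changeIndices N x).card := by
  have hk' : ((k + 1 : ℕ) : ℕ∞) ≤ numChanges x 0 1 := by
    push_cast
    exact Order.add_one_le_of_lt hk
  obtain ⟨F, hF, hcard⟩ := Set.exists_subset_encard_eq hk'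
  have hfin : F.Finite := Set.finite_of_encard_eq_coe hcard
  obtain ⟨U, hU, hdisj⟩ := hfin.t2_separation
  have h : ∀ᶠ N : ℕ in atTop, ∀ t ∈ F, ∃ i ∈ changeIndices N x, (i : ℝ≥0) / N ∈ U t := by
    rw [eventually_all_finite hfin]
    exact fun t ht => exists_changeIndices_near hx (hF ht).1.2 (hF ht).2
      ((hU t).2.mem_nhds (hU t).1)
  filter_upwards [h] with N hN
  choose! i hi hiU using hN
  have hinj : Set.InjOn i F := by
    intro s hs t ht hst
    by_contra hne
    refine Set.disjoint_left.1 (hdisj hs ht hne) (hiU s hs) ?_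
    rw [hst]
    exact hiU t ht
  have h1 : F.encard ≤ ((changeIndices N x).card : ℕ∞) := by
    rw [← hinj.encard_image, ← Set.encard_coe_eq_coe_finsetCard]
    refine Set.encard_le_encard ?_
    rintro _ ⟨t, ht, rfl⟩
    exact hi t ht
  rw [hcard] at h1
  exact_mod_cast h1

theorem one_le_numChanges {x : ℝ≥0 → Bool} (hx : ∀ t, ContinuousWithinAt x (Set.Ici t) t)
    (h : x 0 ≠ x 1) : 1 ≤ numChanges x 0 1 := by
  obtain ⟨t, ht, hd⟩ := exists_discontinuity_Ioc hx (le_refl 0) zero_le (le_refl 1) h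
  exact Set.one_le_encard_iff_nonempty.2 ⟨t, ⟨ht.1.le, ht.2⟩, hd⟩

theorem numChanges_congr {x y : ℝ≥0 → Bool} {a b : ℝ≥0} (h : Set.EqOn x y (Set.Icc a b)) :
    numChanges x a b = numChanges y a b := by
  unfold numChanges
  congr 1
  ext t
  simp only [Set.mem_ofPred_eq, and_congr_right_iff]
  intro ht
  rw [continuousWithinAt_congr h (h ht)]

theorem numChanges_const (c : Bool) (a b : ℝ≥0) : numChanges (fun _ => c) a b = 0 := by
  simp [numChanges, continuousWithinAt_const]

theorem continuousWithinAt_gatePath {g a b : ℝ≥0 → Bool} {S : Set ℝ≥0} {t : ℝ≥0}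
    (hg : ContinuousWithinAt g S t) (ha : ContinuousWithinAt a S t)
    (hb : ContinuousWithinAt b S t) : ContinuousWithinAt (gatePath (g, a, b)) S t :=
  (continuous_of_discreteTopology (f := fun q : Bool × Bool × Bool =>
    gateOutput q.1 q.2.1 q.2.2)).continuousAt.comp_continuousWithinAt (hg.prodMk (ha.prodMk hb))

theorem continuousWithinAt_andOr {n : ℕ} {x : TreeVertex n → ℝ≥0 → Bool} {S : Set ℝ≥0} {t : ℝ≥0}
    (hx : ∀ v, ContinuousWithinAt (x v) S t) :
    ContinuousWithinAt (fun s => andOr n fun v => x v s) S t := by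
  induction n with
  | zero =>
    have h : (fun s => andOr 0 fun v => x v s) = x .root := by
      funext s
      exact gateOutput_leaf _
    rw [h]
    exact hx _
  | succ n ih =>
    exact continuousWithinAt_gatePath (hx .root) (ih (x := fun v => x v.left) fun v => hx _)
      (ih (x := fun v => x v.right) fun v => hx _)

/-! ### The probability of a constant out-signal -/

/-- The paths that are `1` at all times of `S`. -/
def onesOn (S : Set ℝ≥0) : Set (ℝ≥0 → Bool) := {w | ∀ t ∈ S, w t = true}

theorem measurableSet_onesOn {S : Set ℝ≥0} (hS : S.Countable) : MeasurableSet (onesOn S) := by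
  have : onesOn S = ⋂ t ∈ S, (fun w : ℝ≥0 → Bool => w t) ⁻¹' {true} := by
    ext w; simp [onesOn]
  rw [this]
  exact MeasurableSet.biInter hS fun t _ => measurable_pi_apply t (measurableSet_singleton _)

theorem onesOn_anti {S S' : Set ℝ≥0} (h : S ⊆ S') : onesOn S' ⊆ onesOn S :=
  fun _ hw t ht => hw t (h ht)

/-- The right side is (1 + e^(-d))/2, so this is the AM-GM inequality. The left side is the
probability of no jump at rate 1/2, and it is multiplicative over grid steps. -/
theorem exp_half_le_bitTransition (d : ℝ) :
    Real.exp (-d / 2) ≤ bitTransition (1 / 2) d true true := by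
  have h : Real.exp (-d) = Real.exp (-d / 2) ^ 2 := by
    rw [← Real.exp_nat_mul]; congr 1; push_cast; ring
  simp only [bitTransition, bernoulliWeight_half, if_true, h]
  nlinarith [sq_nonneg (1 - Real.exp (-d / 2))]

theorem IsChainLaw.le_measureReal_ones {W : Measure (ℝ≥0 → Bool)} (h : IsChainLaw W)
    {t : ℕ → ℝ≥0} (ht : Monotone t) (k : ℕ) :
    1 / 2 * Real.exp (-((t k : ℝ) - t 0) / 2) ≤ W.real {w | ∀ j ≤ k, w (t j) = true} := by
  have hprod : Real.exp (-((t k : ℝ) - t 0) / 2) ≤ ∏ j ∈ Finset.range k,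
      bitTransition (1 / 2) ((t (j + 1) : ℝ) - t j) true true := by
    induction k with
    | zero => simp
    | succ k ih =>
      rw [Finset.prod_range_succ]
      have : Real.exp (-((t (k + 1) : ℝ) - t 0) / 2)
          = Real.exp (-((t k : ℝ) - t 0) / 2) * Real.exp (-((t (k + 1) : ℝ) - t k) / 2) := by
        rw [← Real.exp_add]; congr 1; ring
      rw [this]
      exact mul_le_mul ih (exp_half_le_bitTransition _) (Real.exp_pos _).le
        ((Real.exp_pos _).le.trans ih)
  have hlaw := h.law t ht (fun _ => true) k
  have : W.real {w | ∀ j ≤ k, w (t j) = true} = 1 / 2 * ∏ j ∈ Finset.range k,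
      bitTransition (1 / 2) ((t (j + 1) : ℝ) - t j) true true := by
    rw [measureReal_def, hlaw, ENNReal.toReal_ofReal]
    exact mul_nonneg (by norm_num) ((Real.exp_pos _).le.trans hprod)
  rw [this]
  gcongr

theorem measureReal_eval_true {W : Measure (ℝ≥0 → Bool)} (h : IsChainLaw W) (n : ℕ) (t : ℝ≥0) :
    (outputLaw W n).real {w | w t = true} = 1 / 2 := by
  have := h.isProb
  have := isProbabilityMeasure_outputLaw W n
  have hm : MeasurableSet {w : ℝ≥0 → Bool | w t = true} :=
    (measurable_pi_apply t : Measurable fun w : ℝ≥0 → Bool => w t) (measurableSet_singleton true)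
  have h1 : (outputLaw W n).real {w | w t = true} = (outputLaw W n).real {w | w t = true}ᶜ := by
    conv_lhs => rw [← map_flipPath_outputLaw h n]
    rw [map_measureReal_apply measurable_flipPath hm]
    congr 1
    ext w
    simp [flipPath]
  rw [probReal_compl_eq_one_sub hm] at h1
  linarith

theorem measureReal_onesOn_singleton {W : Measure (ℝ≥0 → Bool)} (h : IsChainLaw W) (n : ℕ)
    (t : ℝ≥0) : (outputLaw W n).real (onesOn {t}) = 1 / 2 := by
  rw [← measureReal_eval_true h n t]
  simp [onesOn]

theorem measureReal_onesOn_shift {W : Measure (ℝ≥0 → Bool)} (h : IsChainLaw W) (n : ℕ) (s : ℝ≥0)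
    {S : Set ℝ≥0} (hS : S.Countable) :
    (outputLaw W n).real (onesOn ((· + s) '' S)) = (outputLaw W n).real (onesOn S) := by
  conv_rhs => rw [← map_shiftPath_outputLaw h s n]
  rw [map_measureReal_apply (measurable_shiftPath s) (measurableSet_onesOn hS)]
  congr 1
  ext w
  simp [onesOn, shiftPath]

/-- A lower bound for the probability that the out-signal is `1` throughout: the gate is OR
throughout, and one of the children is `1` throughout or the children relay each other, or the gate
is not OR throughout and both children are `1` throughout. -/
theorem le_measureReal_onesOn_succ {W : Measure (ℝ≥0 → Bool)} [IsProbabilityMeasure W] (n : ℕ)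
    {S S₁ S₂ : Set ℝ≥0} (hS : S = S₁ ∪ S₂) (h₁ : S₁.Countable) (h₂ : S₂.Countable)
    {q a a₁ a₂ : ℝ} (hq : W.real (onesOn S) = q) (ha : (outputLaw W n).real (onesOn S) = a)
    (ha₁ : (outputLaw W n).real (onesOn S₁) = a₁) (ha₂ : (outputLaw W n).real (onesOn S₂) = a₂) :
    q * (2 * a - a ^ 2 + (a₁ - a) * (a₂ - a)) + (1 - q) * a ^ 2 ≤
      (outputLaw W (n + 1)).real (onesOn S) := by
  have hL := isProbabilityMeasure_outputLaw W n
  set L := outputLaw W n with hLdef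
  have hO : MeasurableSet (onesOn S) := measurableSet_onesOn (hS ▸ h₁.union h₂)
  have hO₁ := measurableSet_onesOn h₁
  have hO₂ := measurableSet_onesOn h₂
  set O := onesOn S with hOdef
  -- Disjoint pieces: the first child is 1 throughout; only the second is; neither is, but they
  -- relay.
  set E : Set ((ℝ≥0 → Bool) × (ℝ≥0 → Bool)) :=
    (O ×ˢ Set.univ ∪ Oᶜ ×ˢ O) ∪ (onesOn S₁ \ O) ×ˢ (onesOn S₂ \ O) with hE
  have hsub₁ : O ⊆ onesOn S₁ := onesOn_anti (hS ▸ Set.subset_union_left)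
  have hsub₂ : O ⊆ onesOn S₂ := onesOn_anti (hS ▸ Set.subset_union_right)
  have hEm : (L.prod L).real E = 2 * a - a ^ 2 + (a₁ - a) * (a₂ - a) := by
    rw [hE, measureReal_union, measureReal_union, measureReal_prod_prod, measureReal_prod_prod,
      measureReal_prod_prod, probReal_univ, probReal_compl_eq_one_sub hO,
      measureReal_sdiff hsub₁ hO, measureReal_sdiff hsub₂ hO, ha, ha₁, ha₂]
    · ring
    · rw [Set.disjoint_left]
      rintro ⟨x, y⟩ hx hy
      exact hy.1 hx.1
    · exact hO.compl.prod hO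
    · rw [Set.disjoint_left]
      rintro ⟨x, y⟩ (hx | hx) hy
      · exact hy.1.2 hx.1
      · exact hy.2.2 hx.2
    · exact (hO₁.diff hO).prod (hO₂.diff hO)
  have hT : (W.prod (L.prod L)).real (O ×ˢ E ∪ Oᶜ ×ˢ (O ×ˢ O)) =
      q * (2 * a - a ^ 2 + (a₁ - a) * (a₂ - a)) + (1 - q) * a ^ 2 := by
    rw [measureReal_union, measureReal_prod_prod, measureReal_prod_prod, measureReal_prod_prod,
      hEm, probReal_compl_eq_one_sub hO, ha, hq, sq]
    · rw [Set.disjoint_left]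
      rintro ⟨x, y⟩ hx hy
      exact hy.1 hx.1
    · exact hO.compl.prod (hO.prod hO)
  rw [← hT, outputLaw, map_measureReal_apply measurable_gatePath hO]
  refine measureReal_mono ?_
  rintro ⟨g, x, y⟩ (⟨hg, hxy⟩ | ⟨-, hx, hy⟩) t ht
  · have hg' : g t = true := hg t ht
    have : (x t || y t) = true := by
      rcases hxy with (hxy | hxy) | hxy
      · simp [show x t = true from hxy.1 t ht]
      · simp [show y t = true from hxy.2 t ht]
      · rw [hS] at ht
        rcases ht with ht | ht
        · simp [show x t = true from hxy.1.1 t ht]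
        · simp [show y t = true from hxy.2.1 t ht]
    simpa [gatePath, gateOutput, hg'] using this
  · have hx' : x t = true := hx t ht
    have hy' : y t = true := hy t ht
    simp [gatePath, gateOutput, hx', hy']

/-! ### Dyadic grids -/

/-- The `2 ^ m` times `j T / 2 ^ m`, `j < 2 ^ m`. -/
def dyadicGrid (T : ℝ≥0) (m : ℕ) : Set ℝ≥0 :=
  (fun j : ℕ => j * (T / 2 ^ m)) '' Set.Iio (2 ^ m)

theorem countable_dyadicGrid (T : ℝ≥0) (m : ℕ) : (dyadicGrid T m).Countable :=
  (Set.to_countable _).image _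

theorem dyadicGrid_zero (T : ℝ≥0) : dyadicGrid T 0 = {0} := by
  simp [dyadicGrid]

/-- Because the right endpoint is left out, the grid is exactly two translates of the grid of half
the length, as the relay estimate requires. -/
theorem dyadicGrid_succ (T : ℝ≥0) (m : ℕ) :
    dyadicGrid T (m + 1) = dyadicGrid (T / 2) m ∪ (· + T / 2) '' dyadicGrid (T / 2) m := by
  have hstep : T / 2 ^ (m + 1) = T / 2 / 2 ^ m := by
    rw [div_div, pow_succ']
  have hhalf : T / 2 = (2 ^ m : ℕ) * (T / 2 / 2 ^ m) := by
    push_cast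
    field_simp
  ext t
  simp only [dyadicGrid, hstep, Set.mem_union, Set.mem_image, Set.mem_Iio]
  constructor
  · rintro ⟨j, hj, rfl⟩
    rcases lt_or_ge j (2 ^ m) with h | h
    · exact Or.inl ⟨j, h, rfl⟩
    · refine Or.inr ⟨_, ⟨j - 2 ^ m, by rw [pow_succ] at hj; omega, rfl⟩, ?_⟩
      conv_lhs => enter [2]; rw [hhalf]
      rw [← add_mul, ← Nat.cast_add, Nat.sub_add_cancel h]
  · rintro (⟨j, hj, rfl⟩ | ⟨_, ⟨j, hj, rfl⟩, rfl⟩)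
    · exact ⟨j, by rw [pow_succ]; omega, rfl⟩
    · refine ⟨j + 2 ^ m, by rw [pow_succ]; omega, ?_⟩
      conv_rhs => enter [2]; rw [hhalf]
      rw [← add_mul, ← Nat.cast_add]

theorem dyadicGrid_mono (T : ℝ≥0) : Monotone (dyadicGrid T) := by
  refine monotone_nat_of_le_succ fun m => ?_
  rintro _ ⟨j, hj, rfl⟩
  refine ⟨2 * j, ?_, ?_⟩
  · simp only [Set.mem_Iio, pow_succ] at hj ⊢; omega
  · push_cast
    rw [pow_succ]
    field_simp

theorem IsChainLaw.le_measureReal_onesOn_dyadicGrid {W : Measure (ℝ≥0 → Bool)} (h : IsChainLaw W)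
    (T : ℝ≥0) (m : ℕ) :
    1 / 2 * Real.exp (-T / 2) ≤ W.real (onesOn (dyadicGrid T m)) := by
  have := h.isProb
  have hmono : Monotone fun j : ℕ => (j : ℝ≥0) * (T / 2 ^ m) := by
    intro i j hij
    have : (i : ℝ≥0) ≤ j := by exact_mod_cast hij
    exact mul_le_mul_left this _
  have h1 := h.le_measureReal_ones hmono (2 ^ m)
  have h2 : (((2 ^ m : ℕ) : ℝ≥0) * (T / 2 ^ m) : ℝ≥0) = T := by
    push_cast
    field_simp
  simp only [h2] at h1
  simp only [Nat.cast_zero, zero_mul, NNReal.coe_zero, sub_zero] at h1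
  refine h1.trans (measureReal_mono ?_)
  rintro w hw _ ⟨j, hj, rfl⟩
  exact hw j (le_of_lt hj)

/-- Here `r` stands for √T and 7.78 for a bound on 11/√2. If the defect `1 - 2 * a` is below `9.9 *
r`, the loss `r ^ 2 / 2` is affordable. Otherwise `a₁ - a` is at least (9.9 - 7.78)/2 = 1.06 times
`r`, and the relay gain `2 * q * (a₁ - a) ^ 2` outweighs the loss. -/
theorem one_sub_le_sqrt_of_relay {r q a a₁ a' : ℝ} (hr0 : 0 ≤ r) (hr1 : r ≤ 1)
    (hq : 1 - r ^ 2 / 2 ≤ 2 * q) (hq1 : 2 * q ≤ 1) (ha : 1 - 2 * a ≤ 11 * r)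
    (ha₁ : 1 - 2 * a₁ ≤ 7.78 * r)
    (ha' : q * (2 * a - a ^ 2 + (a₁ - a) * (a₁ - a)) + (1 - q) * a ^ 2 ≤ a') :
    1 - 2 * a' ≤ 11 * r := by
  have h1 : 1 - 2 * a' ≤ (1 - 2 * q) + 2 * q * (1 - 2 * a) - 2 * q * (a₁ - a) ^ 2 := by
    nlinarith [mul_nonneg (sub_nonneg.2 hq1) (sq_nonneg a)]
  have hr2 : r ^ 2 ≤ r := by nlinarith
  have hq2 : 1 / 2 ≤ 2 * q := by nlinarith
  rcases le_total (1 - 2 * a) (9.9 * r) with h | h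
  · have h2 : 2 * q * (1 - 2 * a) ≤ 9.9 * r := by
      have : 2 * q * (1 - 2 * a) ≤ 2 * q * (9.9 * r) := mul_le_mul_of_nonneg_left h (by linarith)
      nlinarith
    nlinarith [sq_nonneg (a₁ - a), mul_nonneg (by linarith : (0:ℝ) ≤ 2 * q) (sq_nonneg (a₁ - a))]
  · have h2 : 1.06 * r ≤ a₁ - a := by linarith
    have h3 : r ^ 2 ≤ (a₁ - a) ^ 2 := pow_le_pow_left₀ hr0 (by linarith) 2
    have h4 : 1 / 2 * r ^ 2 ≤ 2 * q * (a₁ - a) ^ 2 :=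
      mul_le_mul hq2 h3 (sq_nonneg r) (by linarith)
    have h5 : 2 * q * (1 - 2 * a) ≤ 11 * r := by
      have : 2 * q * (1 - 2 * a) ≤ 2 * q * (11 * r) := mul_le_mul_of_nonneg_left ha (by linarith)
      nlinarith
    linarith

theorem measureReal_onesOn_dyadicGrid_zero {W : Measure (ℝ≥0 → Bool)} (h : IsChainLaw W) (n : ℕ)
    (T : ℝ≥0) : (outputLaw W n).real (onesOn (dyadicGrid T 0)) = 1 / 2 := by
  rw [dyadicGrid_zero, measureReal_onesOn_singleton h]

theorem measureReal_onesOn_le_half {W : Measure (ℝ≥0 → Bool)} (h : IsChainLaw W) (n : ℕ)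
    (T : ℝ≥0) (m : ℕ) : (outputLaw W n).real (onesOn (dyadicGrid T m)) ≤ 1 / 2 := by
  have := h.isProb
  have := isProbabilityMeasure_outputLaw W n
  rw [← measureReal_onesOn_dyadicGrid_zero h n T]
  exact measureReal_mono (onesOn_anti (dyadicGrid_mono T (Nat.zero_le m)))

/-- The probability of a change of the out-signal on a time interval of length `T` is at most of
order `√T`, uniformly in the depth. -/
theorem one_sub_two_mul_measureReal_onesOn_le {W : Measure (ℝ≥0 → Bool)} (h : IsChainLaw W)
    (n m : ℕ) (T : ℝ≥0) (hT : T ≤ 1) :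
    1 - 2 * (outputLaw W n).real (onesOn (dyadicGrid T m)) ≤ 11 * √(T : ℝ) := by
  have := h.isProb
  have hq : ∀ (T : ℝ≥0) m, 1 - (T : ℝ) / 2 ≤ 2 * W.real (onesOn (dyadicGrid T m)) := by
    intro T m
    have h1 := h.le_measureReal_onesOn_dyadicGrid T m
    have h2 := Real.add_one_le_exp (-(T : ℝ) / 2)
    linarith
  induction n generalizing m T with
  | zero =>
    have h1 := hq T m
    have hT' : (T : ℝ) ≤ 1 := hT
    have h2 : (T : ℝ) ≤ √(T : ℝ) := Real.le_sqrt_of_sq_le (by nlinarith [T.2])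
    simp only [outputLaw]
    linarith [T.2]
  | succ n ih =>
    cases m with
    | zero =>
      rw [measureReal_onesOn_dyadicGrid_zero h]
      linarith [Real.sqrt_nonneg (T : ℝ)]
    | succ m =>
      have hrec := le_measureReal_onesOn_succ (W := W) n (dyadicGrid_succ T m)
        (countable_dyadicGrid _ _) ((countable_dyadicGrid _ _).image _) rfl rfl rfl
        (measureReal_onesOn_shift h n (T / 2) (countable_dyadicGrid (T / 2) m))
      have hsq : √(T : ℝ) ^ 2 = T := Real.sq_sqrt T.2
      have hT' : (T : ℝ) ≤ 1 := hT
      refine one_sub_le_sqrt_of_relay (Real.sqrt_nonneg _) (Real.sqrt_le_one.2 hT') ?_ ?_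
        (ih (m + 1) T hT) ?_ hrec
      · rw [hsq]; exact hq T (m + 1)
      · have := measureReal_onesOn_le_half h 0 T (m + 1)
        simp only [outputLaw] at this
        linarith
      · refine (ih m (T / 2) ((div_le_self zero_le one_le_two).trans hT)).trans ?_
        have : √((T / 2 : ℝ≥0) : ℝ) ≤ 0.7072 * √(T : ℝ) := by
          rw [Real.sqrt_le_left (by positivity), mul_pow, hsq]
          push_cast
          nlinarith [T.2]
        linarith [Real.sqrt_nonneg (T : ℝ)]

/-- For the short length 1/1024 the square-root bound is nontrivial. Each doubling uses a gate that
is OR throughout and children of which one covers each half, at the cost of squaring `α` and a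
factor `e`. -/
theorem exists_le_measureReal_onesOn_dyadicGrid {W : Measure (ℝ≥0 → Bool)} (h : IsChainLaw W)
    (k : ℕ) : ∃ α : ℝ, 0 < α ∧
      ∀ n m, α ≤ (outputLaw W n).real (onesOn (dyadicGrid (2 ^ k / 1024) m)) := by
  have := h.isProb
  induction k with
  | zero =>
    -- The defect is at most 11/32, so the probability is at least 21/64.
    refine ⟨0.3, by norm_num, fun n m => ?_⟩
    have h1 := one_sub_two_mul_measureReal_onesOn_le h n m (2 ^ 0 / 1024)
      (by rw [div_le_one (by norm_num)]; norm_num)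
    have h2 : √((2 ^ 0 / 1024 : ℝ≥0) : ℝ) = 1 / 32 := by
      rw [Real.sqrt_eq_iff_mul_self_eq (by positivity) (by norm_num)]
      push_cast
      norm_num
    rw [h2] at h1
    linarith
  | succ k ih =>
    obtain ⟨α, hα, hle⟩ := ih
    set T : ℝ≥0 := 2 ^ (k + 1) / 1024 with hTdef
    have hT2 : T / 2 = 2 ^ k / 1024 := by
      rw [hTdef, pow_succ]; field_simp
    have hα2 : α ≤ 1 / 2 := (hle 0 0).trans (measureReal_onesOn_le_half h 0 _ 0)
    have hα3 : α ^ 2 ≤ 1 := by nlinarith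
    set e := 1 / 2 * Real.exp (-(T : ℝ) / 2) with he
    have he0 : 0 < e := by positivity
    have he1 : e ≤ 1 / 2 := by
      have : Real.exp (-(T : ℝ) / 2) ≤ 1 := Real.exp_le_one_iff.2 (by linarith [T.2])
      linarith
    refine ⟨e * α ^ 2, by positivity, fun n m => ?_⟩
    cases n with
    | zero =>
      exact (mul_le_of_le_one_right he0.le hα3).trans (h.le_measureReal_onesOn_dyadicGrid T m)
    | succ n =>
      cases m with
      | zero =>
        rw [measureReal_onesOn_dyadicGrid_zero h]
        exact (mul_le_of_le_one_right he0.le hα3).trans he1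
      | succ m =>
        have hrec := le_measureReal_onesOn_succ (W := W) n (dyadicGrid_succ T m)
          (countable_dyadicGrid _ _) ((countable_dyadicGrid _ _).image _) rfl rfl rfl
          (measureReal_onesOn_shift h n (T / 2) (countable_dyadicGrid (T / 2) m))
        refine le_trans ?_ hrec
        have hq := h.le_measureReal_onesOn_dyadicGrid T (m + 1)
        have hq2 := measureReal_onesOn_le_half h 0 T (m + 1)
        have hL := isProbabilityMeasure_outputLaw W n
        have ha := hle n m
        rw [← hT2] at ha
        have ha1 := measureReal_onesOn_le_half h n (T / 2) m
        simp only [outputLaw] at hq2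
        set q := W.real (onesOn (dyadicGrid T (m + 1)))
        set a₁ := (outputLaw W n).real (onesOn (dyadicGrid (T / 2) m))
        have ha0 : 0 ≤ (outputLaw W n).real (onesOn (dyadicGrid T (m + 1))) := measureReal_nonneg
        set a := (outputLaw W n).real (onesOn (dyadicGrid T (m + 1)))
        -- The right side equals `a₁ ^ 2 + 2 * a * (1 - a₁)`.
        have h1 : α ^ 2 ≤ 2 * a - a ^ 2 + (a₁ - a) * (a₁ - a) := by
          have : α ^ 2 ≤ a₁ ^ 2 := pow_le_pow_left₀ hα.le ha 2
          nlinarith [mul_nonneg ha0 (by linarith : (0:ℝ) ≤ 1 - a₁)]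
        have h2 : e * α ^ 2 ≤ q * (2 * a - a ^ 2 + (a₁ - a) * (a₁ - a)) :=
          mul_le_mul hq h1 (by positivity) (he0.le.trans hq)
        have h3 : 0 ≤ (1 - q) * a ^ 2 := mul_nonneg (by linarith) (sq_nonneg _)
        linarith

/-- The paths that are `1` at all dyadic times in `[0, 2)`. -/
def onesOnDyadics : Set (ℝ≥0 → Bool) := ⋂ m, onesOn (dyadicGrid 2 m)

theorem measurableSet_onesOnDyadics : MeasurableSet onesOnDyadics :=
  MeasurableSet.iInter fun m => measurableSet_onesOn (countable_dyadicGrid 2 m)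

theorem exists_le_measure_onesOnDyadics {W : Measure (ℝ≥0 → Bool)} (h : IsChainLaw W) :
    ∃ α : ℝ, 0 < α ∧ ∀ n, α ≤ (outputLaw W n).real onesOnDyadics := by
  have := h.isProb
  obtain ⟨α, hα, hle⟩ := exists_le_measureReal_onesOn_dyadicGrid h 11
  refine ⟨α, hα, fun n => ?_⟩
  have hL := isProbabilityMeasure_outputLaw W n
  have h2 : (2 ^ 11 / 1024 : ℝ≥0) = 2 := by
    rw [div_eq_iff (by norm_num)]; norm_num
  rw [h2] at hle
  have ht := tendsto_measure_iInter_atTop (μ := outputLaw W n)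
    (s := fun m => onesOn (dyadicGrid 2 m))
    (fun m => (measurableSet_onesOn (countable_dyadicGrid 2 m)).nullMeasurableSet)
    (fun i j hij => onesOn_anti (dyadicGrid_mono 2 hij)) ⟨0, measure_ne_top _ _⟩
  have h3 : ENNReal.ofReal α ≤ outputLaw W n onesOnDyadics :=
    ge_of_tendsto' ht fun m => ENNReal.ofReal_le_of_le_toReal (hle n m)
  exact (ENNReal.ofReal_le_iff_le_toReal (measure_ne_top _ _)).1 h3

/-- Every `t ≤ 1` has dyadic times just to its right inside [0,2), also `t = 1`; right-continuity
does the rest. -/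
theorem eqOn_true_of_mem_onesOnDyadics {x : ℝ≥0 → Bool}
    (hx : ∀ t, ContinuousWithinAt x (Set.Ici t) t) (h : x ∈ onesOnDyadics) :
    Set.EqOn x (fun _ => true) (Set.Icc 0 1) := by
  intro t ht
  have ht2 : t < 2 := ht.2.trans_lt one_lt_two
  obtain ⟨u, htu, hu2, hc⟩ := exists_Ico_const (hx t) ht2
  obtain ⟨m, hm⟩ := exists_pow_lt_of_lt_one (show (0 : ℝ) < ((u : ℝ) - t) / 2 from
    half_pos (sub_pos.2 htu)) (show (1 / 2 : ℝ) < 1 by norm_num)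
  set d : ℝ≥0 := 2 / 2 ^ m with hd
  have hd0 : 0 < d := by positivity
  have hdu : t + d ≤ u := by
    have : (t : ℝ) + d ≤ u := by
      rw [hd]
      push_cast
      rw [one_div, inv_pow, lt_div_iff₀ (by norm_num)] at hm
      rw [div_eq_mul_inv]
      linarith
    exact_mod_cast this
  have h1 : t ≤ (⌈t / d⌉₊ : ℝ≥0) * d := (div_le_iff₀ hd0).1 (Nat.le_ceil _)
  have h2 : (⌈t / d⌉₊ : ℝ≥0) * d < u := by
    refine lt_of_lt_of_le ?_ hdu
    have := Nat.ceil_lt_add_one (a := t / d) zero_le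
    calc (⌈t / d⌉₊ : ℝ≥0) * d < (t / d + 1) * d := by gcongr
      _ = t + d := by field_simp
  have h3 : ⌈t / d⌉₊ < 2 ^ m := by
    have h4 := h2.trans_le hu2
    rw [← lt_div_iff₀ hd0, hd] at h4
    have h5 : (2 : ℝ≥0) / (2 / 2 ^ m) = (2 ^ m : ℕ) := by
      push_cast
      field_simp
    rw [h5, Nat.cast_lt, ← hd] at h4
    exact h4
  rw [← hc _ ⟨h1, h2⟩]
  exact Set.mem_iInter.1 h m _ ⟨_, h3, rfl⟩

/-! ### Two-time laws of the out-signal -/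

/-- The probability that a bit differs at two times at distance `d`. -/
noncomputable def bitDiff (d : ℝ) : ℝ := (1 - Real.exp (-d)) / 2

theorem bitDiff_nonneg {d : ℝ} (hd : 0 ≤ d) : 0 ≤ bitDiff d := by
  have : Real.exp (-d) ≤ 1 := Real.exp_le_one_iff.2 (by linarith)
  unfold bitDiff
  linarith

theorem bitDiff_pos {d : ℝ} (hd : 0 < d) : 0 < bitDiff d := by
  have : Real.exp (-d) < 1 := by rw [Real.exp_lt_one_iff]; linarith
  unfold bitDiff
  linarith

theorem bitDiff_le_half (d : ℝ) : bitDiff d ≤ 1 / 2 := by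
  have := Real.exp_pos (-d)
  unfold bitDiff
  linarith

theorem bitDiff_le (d : ℝ) : bitDiff d ≤ d / 2 := by
  have := Real.add_one_le_exp (-d)
  unfold bitDiff
  linarith

theorem le_bitDiff {d : ℝ} (h0 : 0 ≤ d) (h1 : d ≤ 1) : d / 4 ≤ bitDiff d := by
  have h2 : Real.exp (-d) * (1 + d) ≤ 1 := by
    have := Real.add_one_le_exp d
    calc Real.exp (-d) * (1 + d) ≤ Real.exp (-d) * Real.exp d := by
          gcongr; linarith
      _ = 1 := by rw [← Real.exp_add]; simp
  have h3 : Real.exp (-d) ≤ 1 - d / 2 := by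
    have := Real.exp_pos (-d)
    by_contra! hcon
    nlinarith
  unfold bitDiff
  linarith

theorem bitTransition_half (d : ℝ) (x y : Bool) :
    bitTransition (1 / 2) d x y = if x = y then 1 - bitDiff d else bitDiff d := by
  simp only [bitTransition, bernoulliWeight_half, bitDiff]
  split_ifs <;> ring

/-- The joint law of a path at two times. -/
noncomputable def pairLaw (μ : Measure (ℝ≥0 → Bool)) (s u : ℝ≥0) : Measure (Bool × Bool) :=
  μ.map fun w => (w s, w u)

theorem measurable_evalPair (s u : ℝ≥0) : Measurable fun w : ℝ≥0 → Bool => (w s, w u) :=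
  (measurable_pi_apply s).prodMk (measurable_pi_apply u)

/-- The paths that differ at the times `s` and `u`. -/
def differAt (s u : ℝ≥0) : Set (ℝ≥0 → Bool) := {w | w s ≠ w u}

theorem differAt_eq_preimage (s u : ℝ≥0) :
    differAt s u = (fun w : ℝ≥0 → Bool => (w s, w u)) ⁻¹' {q | q.1 ≠ q.2} := rfl

theorem measurableSet_differAt (s u : ℝ≥0) : MeasurableSet (differAt s u) :=
  measurable_evalPair s u (t := {q | q.1 ≠ q.2}) (Set.to_countable _).measurableSet

theorem isProbabilityMeasure_pairLaw (μ : Measure (ℝ≥0 → Bool)) [IsProbabilityMeasure μ]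
    (s u : ℝ≥0) : IsProbabilityMeasure (pairLaw μ s u) :=
  Measure.isProbabilityMeasure_map (measurable_evalPair s u).aemeasurable

theorem IsChainLaw.pairLaw_singleton {W : Measure (ℝ≥0 → Bool)} (h : IsChainLaw W) {s u : ℝ≥0}
    (hsu : s ≤ u) (i j : Bool) :
    (pairLaw W s u).real {(i, j)} =
      if i = j then (1 - bitDiff (u - s)) / 2 else bitDiff (u - s) / 2 := by
  have hmono : Monotone fun k : ℕ => if k = 0 then s else u := by
    intro a b hab
    dsimp only
    split_ifs with h1 h2 <;> first | exact le_rfl | exact hsu | omega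
  have hlaw := h.law _ hmono (fun k => if k = 0 then i else j) 1
  simp only [Finset.prod_range_one, zero_add, if_true, one_ne_zero, if_false] at hlaw
  have hset : (fun w : ℝ≥0 → Bool => (w s, w u)) ⁻¹' {(i, j)} =
      {w | ∀ k ≤ 1, w (if k = 0 then s else u) = if k = 0 then i else j} := by
    ext w
    simp only [Set.mem_preimage, Set.mem_singleton_iff, Prod.mk.injEq, Set.mem_ofPred_eq]
    constructor
    · rintro ⟨h1, h2⟩ k hk
      interval_cases k <;> simp [h1, h2]
    · intro hw
      exact ⟨by simpa using hw 0 (by norm_num), by simpa using hw 1 le_rfl⟩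
  have h0 : 0 ≤ bitDiff (u - s) := bitDiff_nonneg (sub_nonneg.2 hsu)
  have h1 := bitDiff_le_half (u - s)
  rw [pairLaw, map_measureReal_apply (measurable_evalPair s u) (measurableSet_singleton _), hset,
    measureReal_def, hlaw, bitTransition_half, ENNReal.toReal_ofReal]
  · split_ifs <;> ring
  · split_ifs <;> nlinarith

theorem measureReal_differAt_eq (μ : Measure (ℝ≥0 → Bool)) [IsProbabilityMeasure μ] (s u : ℝ≥0) :
    μ.real (differAt s u) =
      (pairLaw μ s u).real {(true, false)} + (pairLaw μ s u).real {(false, true)} := by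
  have := isProbabilityMeasure_pairLaw μ s u
  rw [differAt_eq_preimage,
    ← map_measureReal_apply (measurable_evalPair s u) (Set.to_countable _).measurableSet,
    ← measureReal_union (by simp) (measurableSet_singleton _), pairLaw]
  congr 1
  ext ⟨a, b⟩
  cases a <;> cases b <;> simp

theorem IsChainLaw.measureReal_differAt {W : Measure (ℝ≥0 → Bool)} (h : IsChainLaw W)
    {s u : ℝ≥0} (hsu : s ≤ u) : W.real (differAt s u) = bitDiff (u - s) := by
  have := h.isProb
  rw [measureReal_differAt_eq, h.pairLaw_singleton hsu, h.pairLaw_singleton hsu]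
  simp

/-- Both marginals are uniform, so the law on pairs of bits has a single free parameter. -/
theorem pairLaw_outputLaw_singleton {W : Measure (ℝ≥0 → Bool)} (h : IsChainLaw W) (n : ℕ)
    (s u : ℝ≥0) (i j : Bool) :
    (pairLaw (outputLaw W n) s u).real {(i, j)} =
      if i = j then (1 - (outputLaw W n).real (differAt s u)) / 2
      else (outputLaw W n).real (differAt s u) / 2 := by
  have := h.isProb
  have := isProbabilityMeasure_outputLaw W n
  have := isProbabilityMeasure_pairLaw (outputLaw W n) s u
  have hd := measureReal_differAt_eq (outputLaw W n) s u
  have h1 : (pairLaw (outputLaw W n) s u).real {(true, true)} +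
      (pairLaw (outputLaw W n) s u).real {(true, false)} = 1 / 2 := by
    rw [← measureReal_eval_true h n s, ← measureReal_union (by simp) (measurableSet_singleton _),
      pairLaw, map_measureReal_apply (measurable_evalPair s u) (Set.to_countable _).measurableSet]
    congr 1
    ext w
    cases hw : w u <;> simp [hw]
  have h2 : (pairLaw (outputLaw W n) s u).real {(true, true)} +
      (pairLaw (outputLaw W n) s u).real {(false, true)} = 1 / 2 := by
    rw [← measureReal_eval_true h n u, ← measureReal_union (by simp) (measurableSet_singleton _),
      pairLaw, map_measureReal_apply (measurable_evalPair s u) (Set.to_countable _).measurableSet]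
    congr 1
    ext w
    cases hw : w s <;> simp [hw]
  have h3 : (pairLaw (outputLaw W n) s u).real {(false, false)} +
      (pairLaw (outputLaw W n) s u).real {(false, true)} +
      ((pairLaw (outputLaw W n) s u).real {(true, false)} +
      (pairLaw (outputLaw W n) s u).real {(true, true)}) = 1 := by
    have := sum_measureReal_singleton (μ := pairLaw (outputLaw W n) s u) Finset.univ
    rw [Finset.coe_univ, probReal_univ, Fintype.sum_prod_type] at this
    simp only [Fintype.sum_bool] at this
    linarith
  cases i <;> cases j <;> simp <;> linarith

/-- The two terms correspond to a gate with equal and with different states at the two times. By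
symmetry it suffices to compute the mass of (true, false), a finite sum over gate and child pairs.
-/
theorem measureReal_differAt_succ {W : Measure (ℝ≥0 → Bool)} (h : IsChainLaw W) (n : ℕ)
    {s u : ℝ≥0} (hsu : s ≤ u) {γ η : ℝ} (hγ : bitDiff (u - s) = γ)
    (hη : (outputLaw W n).real (differAt s u) = η) :
    (outputLaw W (n + 1)).real (differAt s u) =
      (1 - γ) * (η - η ^ 2 / 2) + γ * (1 / 2 + η ^ 2 / 2) := by
  have := h.isProb
  have := isProbabilityMeasure_outputLaw W n
  have := isProbabilityMeasure_pairLaw W s u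
  have := isProbabilityMeasure_pairLaw (outputLaw W n) s u
  let G : (Bool × Bool) × (Bool × Bool) × (Bool × Bool) → Bool × Bool := fun q =>
    (gateOutput q.1.1 q.2.1.1 q.2.2.1, gateOutput q.1.2 q.2.1.2 q.2.2.2)
  have hG : Measurable G := measurable_of_countable _
  set ν := pairLaw (outputLaw W n) s u with hν
  have hmap : pairLaw (outputLaw W (n + 1)) s u = ((pairLaw W s u).prod (ν.prod ν)).map G := by
    have he := measurable_evalPair s u
    rw [hν, pairLaw, pairLaw, pairLaw, outputLaw, Measure.map_map he measurable_gatePath,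
      Measure.map_prod_map _ _ he he, Measure.map_prod_map _ _ he (he.prodMap he),
      Measure.map_map hG (he.prodMap (he.prodMap he))]
    rfl
  have h1 : (pairLaw (outputLaw W (n + 1)) s u).real {(true, false)} =
      (outputLaw W (n + 1)).real (differAt s u) / 2 := by
    rw [pairLaw_outputLaw_singleton h]; simp
  have h2 : (pairLaw (outputLaw W (n + 1)) s u).real {(true, false)} =
      ∑ q : (Bool × Bool) × (Bool × Bool) × (Bool × Bool), if G q = (true, false) then
        (pairLaw W s u).real {q.1} * (ν.real {q.2.1} * ν.real {q.2.2}) else 0 := by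
    rw [hmap, map_measureReal_apply hG (measurableSet_singleton _), ← Finset.sum_filter]
    have hs : G ⁻¹' {(true, false)} =
        (Finset.univ.filter fun q => G q = (true, false) : Finset _) := by
      ext q; simp
    rw [hs, ← sum_measureReal_singleton]
    refine Finset.sum_congr rfl fun q _ => ?_
    rw [← measureReal_prod_prod, ← measureReal_prod_prod, Set.singleton_prod_singleton,
      Set.singleton_prod_singleton]
  have h3 : (outputLaw W (n + 1)).real (differAt s u) = 2 *
      ∑ q : (Bool × Bool) × (Bool × Bool) × (Bool × Bool), if G q = (true, false) then
        (pairLaw W s u).real {q.1} * (ν.real {q.2.1} * ν.real {q.2.2}) else 0 := by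
    rw [← h2, h1]; ring
  rw [h3]
  simp only [Fintype.sum_prod_type, Fintype.sum_bool, hν, h.pairLaw_singleton hsu,
    pairLaw_outputLaw_singleton h, hη, hγ, G, gateOutput]
  simp
  ring

theorem measureReal_differAt_le_half {W : Measure (ℝ≥0 → Bool)} (h : IsChainLaw W) (n : ℕ)
    {s u : ℝ≥0} (hsu : s ≤ u) : (outputLaw W n).real (differAt s u) ≤ 1 / 2 := by
  have hγ0 : 0 ≤ bitDiff (u - s) := bitDiff_nonneg (sub_nonneg.2 hsu)
  have hγ1 := bitDiff_le_half (u - s)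
  induction n with
  | zero => rw [outputLaw, h.measureReal_differAt hsu]; exact hγ1
  | succ n ih =>
    rw [measureReal_differAt_succ h n hsu rfl rfl]
    have h0 : 0 ≤ (outputLaw W n).real (differAt s u) := measureReal_nonneg
    generalize (outputLaw W n).real (differAt s u) = η at *
    generalize bitDiff (u - s) = γ at *
    have h1 : η - η ^ 2 / 2 ≤ 3 / 8 := by nlinarith
    have h2 : 1 / 2 + η ^ 2 / 2 ≤ 5 / 8 := by nlinarith
    nlinarith

/-- Monotonicity of the recursion lets sub- and supersolutions be propagated through the levels. -/
theorem diff_step_mono {γ m η : ℝ} (hγ1 : γ ≤ 1 / 2) (hm : 0 ≤ m) (hmη : m ≤ η) (hη : η ≤ 1 / 2)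
    (hγ0 : 0 ≤ γ) : (1 - γ) * (m - m ^ 2 / 2) + γ * (1 / 2 + m ^ 2 / 2) ≤
      (1 - γ) * (η - η ^ 2 / 2) + γ * (1 / 2 + η ^ 2 / 2) := by
  have h1 : 0 ≤ 1 - (η + m) / 2 - γ := by linarith
  have h2 : 0 ≤ 1 - (η + m) / 2 - γ + γ * (η + m) :=
    add_nonneg h1 (mul_nonneg hγ0 (add_nonneg (hm.trans hmη) hm))
  nlinarith [mul_nonneg (sub_nonneg.2 hmη) h2]

theorem measureReal_differAt_le_sqrt {W : Measure (ℝ≥0 → Bool)} (h : IsChainLaw W) (n : ℕ)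
    {s u : ℝ≥0} (hsu : s ≤ u) :
    (outputLaw W n).real (differAt s u) ≤ 2 * √(bitDiff (u - s)) := by
  have hγ0 : 0 ≤ bitDiff (u - s) := bitDiff_nonneg (sub_nonneg.2 hsu)
  have hγ1 := bitDiff_le_half (u - s)
  have hsq := Real.sq_sqrt hγ0
  have hx0 := Real.sqrt_nonneg (bitDiff (u - s))
  induction n with
  | zero =>
    rw [outputLaw, h.measureReal_differAt hsu]
    nlinarith
  | succ n ih =>
    rcases le_total (1 / 2) (2 * √(bitDiff (u - s))) with hx | hx
    · exact (measureReal_differAt_le_half h (n + 1) hsu).trans hx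
    · rw [measureReal_differAt_succ h n hsu rfl rfl]
      -- With x = √γ ≤ 1/4, the step maps 2x to 2x - 3x²/2 - 2x³ + 4x⁴, which is at most 2x.
      refine (diff_step_mono hγ1 measureReal_nonneg ih hx hγ0).trans ?_
      generalize √(bitDiff (u - s)) = x at *
      rw [← hsq]
      nlinarith [mul_nonneg hx0 (sq_nonneg x), mul_nonneg (sq_nonneg x) (sub_nonneg.2 hx),
        sq_nonneg x]

/-- Below √γ/4 the quadratic loss is too small to cancel the gain from gate changes, so each level
adds at least γ/4 until √γ/4 is reached. -/
theorem min_le_measureReal_differAt {W : Measure (ℝ≥0 → Bool)} (h : IsChainLaw W) (n : ℕ)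
    {s u : ℝ≥0} (hsu : s ≤ u) :
    min (√(bitDiff (u - s)) / 4) (n * (bitDiff (u - s) / 4)) ≤
      (outputLaw W n).real (differAt s u) := by
  have hγ0 : 0 ≤ bitDiff (u - s) := bitDiff_nonneg (sub_nonneg.2 hsu)
  have hγ1 := bitDiff_le_half (u - s)
  have hsq := Real.sq_sqrt hγ0
  have hx0 := Real.sqrt_nonneg (bitDiff (u - s))
  have hx1 : √(bitDiff (u - s)) ≤ 1 := by
    rw [Real.sqrt_le_one]; linarith
  induction n with
  | zero =>
    simp only [Nat.cast_zero, zero_mul]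
    exact (min_le_right _ _).trans measureReal_nonneg
  | succ n ih =>
    rw [measureReal_differAt_succ h n hsu rfl rfl]
    have hη := measureReal_differAt_le_half h n hsu
    generalize (outputLaw W n).real (differAt s u) = η at *
    generalize bitDiff (u - s) = γ at *
    generalize √γ = x at *
    set m := min (x / 4) (n * (γ / 4)) with hm
    have hm0 : 0 ≤ m := le_min (by positivity) (by positivity)
    have hmx : m ≤ x / 4 := min_le_left _ _
    refine le_trans ?_ (diff_step_mono hγ1 hm0 ih hη hγ0)
    have hm2 : m ^ 2 ≤ γ / 16 := by
      have : m ^ 2 ≤ (x / 4) ^ 2 := pow_le_pow_left₀ hm0 hmx 2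
      nlinarith
    have hgm2 : γ * m ≤ γ * (3 / 16) := by
      have : m ≤ 3 / 16 := by nlinarith
      exact mul_le_mul_of_nonneg_left this hγ0
    have hstep : m + γ / 4 ≤ (1 - γ) * (m - m ^ 2 / 2) + γ * (1 / 2 + m ^ 2 / 2) := by
      nlinarith [mul_nonneg hγ0 (sq_nonneg m)]
    refine le_trans ?_ hstep
    rw [hm, ← min_add_add_right]
    refine min_le_min (by linarith) ?_
    push_cast
    linarith

theorem eventually_sqrt_le_measureReal_differAt {W : Measure (ℝ≥0 → Bool)} (h : IsChainLaw W)
    {s u : ℝ≥0} (hsu : s < u) (hu : (u : ℝ) - s ≤ 1) :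
    ∀ᶠ n : ℕ in atTop, √((u : ℝ) - s) / 8 ≤ (outputLaw W n).real (differAt s u) := by
  have hpos : (0 : ℝ) < u - s := sub_pos.2 hsu
  have hγ := bitDiff_pos hpos
  have h1 : √((u : ℝ) - s) / 8 ≤ √(bitDiff (u - s)) / 4 := by
    have : √((u : ℝ) - s) / 2 ≤ √(bitDiff (u - s)) := by
      refine Real.le_sqrt_of_sq_le ?_
      rw [div_pow, Real.sq_sqrt hpos.le]
      linarith [le_bitDiff hpos.le hu]
    linarith
  have ht : Tendsto (fun n : ℕ => (n : ℝ) * (bitDiff (u - s) / 4)) atTop atTop :=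
    tendsto_natCast_atTop_atTop.atTop_mul_const (by positivity)
  filter_upwards [ht.eventually_ge_atTop (√(bitDiff (u - s)) / 4)] with n hn
  refine h1.trans (le_trans ?_ (min_le_measureReal_differAt h n hsu.le))
  rw [min_eq_left hn]

/-! ### Pairs of changes -/

theorem gateOutput_ne {g a b g' a' b' : Bool} (h : gateOutput g a b ≠ gateOutput g' a' b') :
    g ≠ g' ∨ a ≠ a' ∨ b ≠ b' := by
  by_contra! hcon
  obtain ⟨rfl, rfl, rfl⟩ := hcon
  exact h rfl

theorem eq_not_of_gateOutput_ne_left {g a b a' : Bool}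
    (h : gateOutput g a b ≠ gateOutput g a' b) : b = !g := by
  revert h; cases g <;> cases b <;> simp [gateOutput]

theorem eq_not_of_gateOutput_ne_right {g a b b' : Bool}
    (h : gateOutput g a b ≠ gateOutput g a b') : a = !g := by
  revert h; cases g <;> cases a <;> simp [gateOutput]

/-- If the out-signal of a gate changes on two time intervals, then the gate state changes, or the
in-signals change on different intervals, or one in-signal changes on both intervals and is let
through both times. -/
theorem change_cases {g₁ g₂ g₃ g₄ a₁ a₂ a₃ a₄ b₁ b₂ b₃ b₄ : Bool}
    (h : gateOutput g₁ a₁ b₁ ≠ gateOutput g₂ a₂ b₂)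
    (h' : gateOutput g₃ a₃ b₃ ≠ gateOutput g₄ a₄ b₄) :
    g₁ ≠ g₂ ∨ g₃ ≠ g₄ ∨ (a₁ ≠ a₂ ∧ b₃ ≠ b₄) ∨ (b₁ ≠ b₂ ∧ a₃ ≠ a₄) ∨
      ((a₁ ≠ a₂ ∧ a₃ ≠ a₄) ∧ b₁ = !g₁ ∧ b₃ = !g₃) ∨
      ((b₁ ≠ b₂ ∧ b₃ ≠ b₄) ∧ a₁ = !g₁ ∧ a₃ = !g₃) := by
  by_contra! hcon
  obtain ⟨rfl, rfl, h1, h2, h3, h4⟩ := hcon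
  have e1 := gateOutput_ne h
  have e2 := gateOutput_ne h'
  simp only [ne_eq, not_true_eq_false, false_or] at e1 e2
  by_cases ha : a₁ = a₂
  · have hb : b₁ ≠ b₂ := e1.resolve_left fun hne => hne ha
    have ha' : a₃ = a₄ := h2 hb
    have hb' : b₃ ≠ b₄ := e2.resolve_left fun hne => hne ha'
    subst ha ha'
    exact h4 ⟨hb, hb'⟩ (eq_not_of_gateOutput_ne_right h) (eq_not_of_gateOutput_ne_right h')
  · have hb' : b₃ = b₄ := h1 ha
    have ha' : a₃ ≠ a₄ := e2.resolve_right fun hne => hne hb'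
    have hb : b₁ = b₂ := by
      by_contra hb
      exact ha' (h2 hb)
    subst hb hb'
    exact h3 ⟨ha, ha'⟩ (eq_not_of_gateOutput_ne_left h) (eq_not_of_gateOutput_ne_left h')

/-- The left side is the probability that a child is transparent to its sibling at both times. A
gate change can only lower it, since η ≤ 1/2. -/
theorem sum_pairLaw_mul_pairLaw_not_le {W : Measure (ℝ≥0 → Bool)} (h : IsChainLaw W) (n : ℕ)
    {s s' : ℝ≥0} (hs : s ≤ s') :
    ∑ e : Bool × Bool, (pairLaw W s s').real {e} *
      (pairLaw (outputLaw W n) s s').real {(!e.1, !e.2)} ≤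
      (1 - (outputLaw W n).real (differAt s s')) / 2 := by
  simp only [Fintype.sum_prod_type, Fintype.sum_bool, h.pairLaw_singleton hs,
    pairLaw_outputLaw_singleton h]
  have hγ0 : 0 ≤ bitDiff (s' - s) := bitDiff_nonneg (sub_nonneg.2 hs)
  have h1 := measureReal_differAt_le_half h n hs
  simp
  nlinarith [mul_nonneg hγ0 (by linarith : 0 ≤ 1 - 2 * (outputLaw W n).real (differAt s s'))]

/-- Either child may carry both changes, each with transparency probability at most (1 - η)/2;
together they give the contraction factor. All other cases of `change_cases` go into the error. -/
theorem measureReal_differAt_inter_succ_le {W : Measure (ℝ≥0 → Bool)} (h : IsChainLaw W) (n : ℕ)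
    {s u s' u' : ℝ≥0} (hsu : s ≤ u) (hsu' : s' ≤ u') (hss' : s ≤ s') {d : ℝ}
    (hd : (u : ℝ) - s = d) (hd' : (u' : ℝ) - s' = d) :
    (outputLaw W (n + 1)).real (differAt s u ∩ differAt s' u') ≤
      (outputLaw W n).real (differAt s u ∩ differAt s' u') *
        (1 - (outputLaw W n).real (differAt s s')) + 5 * d := by
  have := h.isProb
  have := isProbabilityMeasure_outputLaw W n
  set L := outputLaw W n with hL
  set C := differAt s u with hC
  set C' := differAt s' u' with hC'
  set E : Bool × Bool → Set (ℝ≥0 → Bool) :=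
    fun e => (fun w : ℝ≥0 → Bool => (w s, w s')) ⁻¹' {e} with hE
  have hEm : ∀ (μ : Measure (ℝ≥0 → Bool)) e, μ.real (E e) = (pairLaw μ s s').real {e} :=
    fun μ e => (map_measureReal_apply (measurable_evalPair s s') (measurableSet_singleton _)).symm
  set T₁ : Set ((ℝ≥0 → Bool) × (ℝ≥0 → Bool) × (ℝ≥0 → Bool)) :=
    ⋃ e ∈ (Finset.univ : Finset (Bool × Bool)), E e ×ˢ ((C ∩ C') ×ˢ E (!e.1, !e.2)) with hT₁
  set T₂ : Set ((ℝ≥0 → Bool) × (ℝ≥0 → Bool) × (ℝ≥0 → Bool)) :=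
    ⋃ e ∈ (Finset.univ : Finset (Bool × Bool)), E e ×ˢ (E (!e.1, !e.2) ×ˢ (C ∩ C')) with hT₂
  set P := W.prod (L.prod L) with hP
  have hsum := sum_pairLaw_mul_pairLaw_not_le h n hss'
  rw [← hL] at hsum
  have hT₁m : P.real T₁ ≤ L.real (C ∩ C') * ((1 - L.real (differAt s s')) / 2) := by
    refine (measureReal_biUnion_finset_le _ _).trans ?_
    refine le_trans (le_of_eq ?_) (mul_le_mul_of_nonneg_left hsum measureReal_nonneg)
    rw [Finset.mul_sum]
    refine Finset.sum_congr rfl fun e _ => ?_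
    rw [measureReal_prod_prod, measureReal_prod_prod, hEm, hEm]
    ring
  have hT₂m : P.real T₂ ≤ L.real (C ∩ C') * ((1 - L.real (differAt s s')) / 2) := by
    refine (measureReal_biUnion_finset_le _ _).trans ?_
    refine le_trans (le_of_eq ?_) (mul_le_mul_of_nonneg_left hsum measureReal_nonneg)
    rw [Finset.mul_sum]
    refine Finset.sum_congr rfl fun e _ => ?_
    rw [measureReal_prod_prod, measureReal_prod_prod, hEm, hEm]
    ring
  have hsub : gatePath ⁻¹' (C ∩ C') ⊆ C ×ˢ Set.univ ∪ (C' ×ˢ Set.univ ∪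
      (Set.univ ×ˢ (C ×ˢ C') ∪ (Set.univ ×ˢ (C' ×ˢ C) ∪ (T₁ ∪ T₂)))) := by
    rintro ⟨g, a, b⟩ ⟨h1, h2⟩
    rcases change_cases h1 h2 with hc | hc | hc | hc | hc | hc
    · exact Or.inl ⟨hc, trivial⟩
    · exact Or.inr (Or.inl ⟨hc, trivial⟩)
    · exact Or.inr (Or.inr (Or.inl ⟨trivial, hc⟩))
    · exact Or.inr (Or.inr (Or.inr (Or.inl ⟨trivial, hc.2, hc.1⟩)))
    · refine Or.inr (Or.inr (Or.inr (Or.inr (Or.inl ?_))))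
      simp only [hT₁, Finset.mem_univ, Set.iUnion_true, Set.mem_iUnion]
      exact ⟨(g s, g s'), rfl, hc.1, Prod.ext hc.2.1 hc.2.2⟩
    · refine Or.inr (Or.inr (Or.inr (Or.inr (Or.inr ?_))))
      simp only [hT₂, Finset.mem_univ, Set.iUnion_true, Set.mem_iUnion]
      exact ⟨(g s, g s'), rfl, Prod.ext hc.2.1 hc.2.2, hc.1⟩
  have hd0 : 0 ≤ d := hd ▸ sub_nonneg.2 hsu
  -- Gate changes cost 2γ ≤ d; changes in different children on the two intervals cost 2 · 4γ ≤ 4d.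
  have hγ := bitDiff_le d
  have hW : W.real C = bitDiff d := by rw [hC, h.measureReal_differAt hsu, hd]
  have hW' : W.real C' = bitDiff d := by rw [hC', h.measureReal_differAt hsu', hd']
  have hLC : L.real C ≤ 2 * √(bitDiff d) := hd ▸ measureReal_differAt_le_sqrt h n hsu
  have hLC' : L.real C' ≤ 2 * √(bitDiff d) := hd' ▸ measureReal_differAt_le_sqrt h n hsu'
  have hCC : L.real C * L.real C' ≤ 4 * bitDiff d := by
    have h1 : L.real C * L.real C' ≤ (2 * √(bitDiff d)) * (2 * √(bitDiff d)) :=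
      mul_le_mul hLC hLC' measureReal_nonneg (by positivity)
    have h2 := Real.mul_self_sqrt (bitDiff_nonneg hd0)
    nlinarith
  rw [outputLaw, map_measureReal_apply measurable_gatePath
    ((measurableSet_differAt s u).inter (measurableSet_differAt s' u'))]
  have hunion := (measureReal_mono (μ := P) hsub).trans ((measureReal_union_le _ _).trans
    (add_le_add le_rfl ((measureReal_union_le _ _).trans (add_le_add le_rfl
      ((measureReal_union_le _ _).trans (add_le_add le_rfl
        ((measureReal_union_le _ _).trans (add_le_add le_rfl (measureReal_union_le _ _)))))))))
  simp only [hP, measureReal_prod_prod, probReal_univ, mul_one, one_mul] at hunion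
  rw [mul_comm (L.real C') (L.real C), hW, hW'] at hunion
  refine hunion.trans ?_
  rw [← hP]
  linarith

/-- The recursion has fixed point `b / θ`, approached geometrically; the factor 2 absorbs the
transient. -/
theorem eventually_le_of_contraction {D : ℕ → ℝ} {θ b : ℝ} (hθ0 : 0 < θ) (hθ1 : θ ≤ 1) (hb : 0 < b)
    (hD : ∀ n, D n ≤ 1) (h : ∀ᶠ n in atTop, D (n + 1) ≤ (1 - θ) * D n + b) :
    ∀ᶠ n in atTop, D n ≤ 2 * b / θ := by
  obtain ⟨n₀, hn₀⟩ := eventually_atTop.1 h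
  have hbound : ∀ k, D (n₀ + k) ≤ b / θ + (1 - θ) ^ k := by
    intro k
    induction k with
    | zero =>
      have : 0 < b / θ := by positivity
      rw [add_zero, pow_zero]
      linarith [hD n₀]
    | succ k ih =>
      have h1 := hn₀ (n₀ + k) (by omega)
      have h2 : (1 - θ) * D (n₀ + k) ≤ (1 - θ) * (b / θ + (1 - θ) ^ k) :=
        mul_le_mul_of_nonneg_left ih (by linarith)
      have h3 : (1 - θ) * (b / θ + (1 - θ) ^ k) + b = b / θ + (1 - θ) ^ (k + 1) := by
        field_simp
        ring
      rw [← h3]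
      exact h1.trans (by linarith)
  have ht := tendsto_pow_atTop_nhds_zero_of_lt_one (sub_nonneg.2 hθ1) (by linarith : 1 - θ < 1)
  obtain ⟨k₀, hk₀⟩ := eventually_atTop.1 (ht.eventually_le_const (show 0 < b / θ by positivity))
  filter_upwards [eventually_ge_atTop (n₀ + k₀)] with n hn
  obtain ⟨k, rfl⟩ := Nat.exists_eq_add_of_le (show n₀ ≤ n by omega)
  have h1 := hbound k
  have h2 := hk₀ k (by omega)
  have : 2 * b / θ = b / θ + b / θ := by ring
  linarith

theorem eventually_measureReal_differAt_inter_le {W : Measure (ℝ≥0 → Bool)} (h : IsChainLaw W)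
    {s u s' u' : ℝ≥0} (hsu : s < u) (hsu' : s' ≤ u') (hss' : s < s') {d : ℝ}
    (hd : (u : ℝ) - s = d) (hd' : (u' : ℝ) - s' = d) (hs1 : (s' : ℝ) - s ≤ 1) :
    ∀ᶠ n : ℕ in atTop, (outputLaw W n).real (differAt s u ∩ differAt s' u') ≤
      80 * d / √((s' : ℝ) - s) := by
  have := h.isProb
  have hd0 : 0 < d := hd ▸ sub_pos.2 hsu
  have hr0 : (0 : ℝ) < s' - s := sub_pos.2 hss'
  have hr := Real.sqrt_pos.2 hr0
  have hr1 : √((s' : ℝ) - s) ≤ 1 := Real.sqrt_le_one.2 hs1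
  have heq : 80 * d / √((s' : ℝ) - s) = 2 * (5 * d) / (√((s' : ℝ) - s) / 8) := by
    field_simp
    norm_num
  rw [heq]
  refine eventually_le_of_contraction (by positivity) (by linarith) (by positivity) ?_ ?_
  · intro n
    have := isProbabilityMeasure_outputLaw W n
    exact measureReal_le_one
  · filter_upwards [eventually_sqrt_le_measureReal_differAt h hss' hs1] with n hn
    refine (measureReal_differAt_inter_succ_le h n hsu.le hsu' hss'.le hd hd').trans ?_
    have : (outputLaw W n).real (differAt s u ∩ differAt s' u') *
        (1 - (outputLaw W n).real (differAt s s')) ≤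
        (outputLaw W n).real (differAt s u ∩ differAt s' u') * (1 - √((s' : ℝ) - s) / 8) :=
      mul_le_mul_of_nonneg_left (by linarith) measureReal_nonneg
    linarith

/-! ### The number of changes along a grid -/

/-- A second moment bound for the number of events that occur. -/
theorem first_moment_le_of_second_moment {α : Type*} [MeasurableSpace α] (μ : Measure α)
    [IsProbabilityMeasure μ] {C : ℕ → Set α} (hC : ∀ i, MeasurableSet (C i)) (N : ℕ) {M : ℝ}
    (hM : 0 ≤ M) {l : ℝ} (hl : 0 < l) :
    ∑ i ∈ Finset.range N, μ.real (C i) ≤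
      M + l / 2 * ∑ i ∈ Finset.range N, ∑ j ∈ Finset.range N, μ.real (C i ∩ C j) +
        1 / (2 * l) * μ.real {x | M < ∑ i ∈ Finset.range N, (C i).indicator 1 x} := by
  set S : α → ℝ := fun x => ∑ i ∈ Finset.range N, (C i).indicator 1 x with hS
  have hint : ∀ E : Set α, MeasurableSet E → Integrable (E.indicator (1 : α → ℝ)) μ :=
    fun E hE => (integrable_const (1 : ℝ)).indicator hE
  have hSm : Measurable S := Finset.measurable_sum _ fun i _ => measurable_one.indicator (hC i)
  have hA : MeasurableSet {x | M < S x} := measurableSet_lt measurable_const hSm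
  have hS1 : ∫ x, S x ∂μ = ∑ i ∈ Finset.range N, μ.real (C i) := by
    rw [hS, integral_finsetSum _ fun i _ => hint _ (hC i)]
    exact Finset.sum_congr rfl fun i _ => integral_indicator_one (hC i)
  have hSq : ∀ x, S x ^ 2 =
      ∑ i ∈ Finset.range N, ∑ j ∈ Finset.range N, (C i ∩ C j).indicator (1 : α → ℝ) x := by
    intro x
    rw [sq, hS, Finset.sum_mul_sum]
    refine Finset.sum_congr rfl fun i _ => Finset.sum_congr rfl fun j _ => ?_
    rw [Set.inter_indicator_one, Pi.mul_apply]
  have hSqint : Integrable (fun x => S x ^ 2) μ := by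
    simp only [hSq]
    exact integrable_finsetSum _ fun i _ => integrable_finsetSum _ fun j _ =>
      hint _ ((hC i).inter (hC j))
  have hS2 : ∫ x, S x ^ 2 ∂μ =
      ∑ i ∈ Finset.range N, ∑ j ∈ Finset.range N, μ.real (C i ∩ C j) := by
    simp only [hSq]
    rw [integral_finsetSum _ fun i _ => integrable_finsetSum _ fun j _ =>
      hint _ ((hC i).inter (hC j))]
    refine Finset.sum_congr rfl fun i _ => ?_
    rw [integral_finsetSum _ fun j _ => hint _ ((hC i).inter (hC j))]
    exact Finset.sum_congr rfl fun j _ => integral_indicator_one ((hC i).inter (hC j))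
  -- On `M < S x` this is AM-GM in the form S ≤ l S²/2 + 1/(2l); elsewhere it is trivial.
  have hpt : ∀ x, S x ≤ M + l / 2 * S x ^ 2 + 1 / (2 * l) * {x | M < S x}.indicator 1 x := by
    intro x
    have h1 : 0 ≤ l / 2 * S x ^ 2 := by positivity
    by_cases hx : M < S x
    · rw [Set.indicator_of_mem (show x ∈ {x | M < S x} from hx), Pi.one_apply, mul_one]
      have hS2 : S x ≤ l / 2 * S x ^ 2 + 1 / (2 * l) := by
        have : l / 2 * S x ^ 2 + 1 / (2 * l) - S x = (l * S x - 1) ^ 2 / (2 * l) := by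
          field_simp; ring
        have h2 : 0 ≤ (l * S x - 1) ^ 2 / (2 * l) := by positivity
        linarith
      linarith
    · rw [Set.indicator_of_notMem (show x ∉ {x | M < S x} from hx), mul_zero]
      linarith
  have hind : Integrable (fun x => 1 / (2 * l) * {x | M < S x}.indicator (1 : α → ℝ) x) μ :=
    (hint _ hA).const_mul _
  have hquad : Integrable (fun x => M + l / 2 * S x ^ 2) μ :=
    (integrable_const M).add (hSqint.const_mul _)
  have hmono := integral_mono (integrable_finsetSum _ fun i _ => hint _ (hC i))
    (hquad.add hind) hpt
  rw [hS1] at hmono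
  refine hmono.trans (le_of_eq ?_)
  simp only [Pi.add_apply]
  rw [integral_add hquad hind, integral_add (integrable_const M) (hSqint.const_mul _),
    integral_const, probReal_univ, one_smul, integral_const_mul, integral_const_mul,
    integral_indicator_one hA, hS2]

/-- The event that the path changes between `i / N` and `(i + 1) / N`. -/
def changeEvent (N i : ℕ) : Set (ℝ≥0 → Bool) := differAt (i / N) ((i + 1 : ℕ) / N)

theorem measurableSet_changeEvent (N i : ℕ) : MeasurableSet (changeEvent N i) :=
  measurableSet_differAt _ _

theorem card_changeIndices_eq_sum (N : ℕ) (x : ℝ≥0 → Bool) :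
    ((changeIndices N x).card : ℝ) = ∑ i ∈ Finset.range N, (changeEvent N i).indicator 1 x := by
  rw [changeIndices, Finset.card_filter, Nat.cast_sum]
  refine Finset.sum_congr rfl fun i _ => ?_
  by_cases hi : x (i / N) ≠ x ((i + 1 : ℕ) / N)
  · rw [if_pos hi, Set.indicator_of_mem (show x ∈ changeEvent N i from hi), Pi.one_apply,
      Nat.cast_one]
  · rw [if_neg hi, Set.indicator_of_notMem (show x ∉ changeEvent N i from hi), Nat.cast_zero]

theorem measurableSet_lt_card_changeIndices (N M : ℕ) :
    MeasurableSet {x : ℝ≥0 → Bool | M < (changeIndices N x).card} := by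
  have : {x : ℝ≥0 → Bool | M < (changeIndices N x).card} =
      {x | (M : ℝ) < ∑ i ∈ Finset.range N, (changeEvent N i).indicator 1 x} := by
    ext x
    simp only [Set.mem_ofPred_eq, ← card_changeIndices_eq_sum, Nat.cast_lt]
  rw [this]
  exact measurableSet_lt measurable_const (Finset.measurable_sum _ fun i _ =>
    measurable_one.indicator (measurableSet_changeEvent N i))

theorem grid_le (N : ℕ) {i j : ℕ} (hij : i ≤ j) : (i : ℝ≥0) / N ≤ (j : ℝ≥0) / N := by
  gcongr

theorem grid_sub (N i j : ℕ) :
    (((j : ℝ≥0) / N : ℝ≥0) : ℝ) - ((i : ℝ≥0) / N : ℝ≥0) = ((j : ℝ) - i) / N := by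
  push_cast
  ring

theorem grid_succ_sub (N i : ℕ) :
    ((((i + 1 : ℕ) : ℝ≥0) / N : ℝ≥0) : ℝ) - ((i : ℝ≥0) / N : ℝ≥0) = 1 / N := by
  rw [grid_sub]
  push_cast
  ring

theorem sum_one_div_sqrt_le (N : ℕ) :
    ∑ d ∈ Finset.range N, 1 / √((d : ℝ) + 1) ≤ 2 * √(N : ℝ) := by
  induction N with
  | zero => simp
  | succ N ih =>
    rw [Finset.sum_range_succ]
    push_cast
    have h1 : √(N : ℝ) ^ 2 = N := Real.sq_sqrt (Nat.cast_nonneg N)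
    have h2 : √((N : ℝ) + 1) ^ 2 = N + 1 := Real.sq_sqrt (by positivity)
    have h3 : 0 < √((N : ℝ) + 1) := Real.sqrt_pos.2 (by positivity)
    have h4 : 1 / √((N : ℝ) + 1) ≤ 2 * √((N : ℝ) + 1) - 2 * √(N : ℝ) := by
      rw [div_le_iff₀ h3]
      nlinarith [sq_nonneg (√((N : ℝ) + 1) - √(N : ℝ))]
    linarith

/-- Sums over pairs of a function bounded by a function of the distance. -/
theorem sum_sum_le_of_le_dist {N : ℕ} {f : ℕ → ℕ → ℝ} {φ : ℕ → ℝ} {B : ℝ} (hφ : Antitone φ)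
    (hφ0 : ∀ d, 0 ≤ φ d) (hsymm : ∀ i j, f i j = f j i)
    (hf : ∀ i j, i ≤ j → j < N → f i j ≤ φ (j - i)) (hB : ∑ d ∈ Finset.range N, φ d ≤ B) :
    ∑ i ∈ Finset.range N, ∑ j ∈ Finset.range N, f i j ≤ N * (2 * B) := by
  have hsub : ∀ K ≤ N, ∑ d ∈ Finset.range K, φ d ≤ B := fun K hK =>
    (Finset.sum_le_sum_of_subset_of_nonneg (Finset.range_subset_range.2 hK)
      fun d _ _ => hφ0 d).trans hB
  have hrow : ∀ i ∈ Finset.range N, ∑ j ∈ Finset.range N, f i j ≤ 2 * B := by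
    intro i hi
    rw [Finset.mem_range] at hi
    rw [← Finset.sum_range_add_sum_Ico _ hi.le]
    have h1 : ∑ j ∈ Finset.range i, f i j ≤ B := by
      refine le_trans ?_ (hsub i hi.le)
      rw [← Finset.sum_range_reflect]
      refine Finset.sum_le_sum fun j hj => ?_
      rw [Finset.mem_range] at hj
      rw [hsymm]
      exact (hf _ _ (by omega) hi).trans (hφ (by omega))
    have h2 : ∑ j ∈ Finset.Ico i N, f i j ≤ B := by
      refine le_trans ?_ (hsub (N - i) (by omega))
      rw [Finset.sum_Ico_eq_sum_range]
      refine Finset.sum_le_sum fun j hj => ?_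
      rw [Finset.mem_range] at hj
      refine (hf _ _ (by omega) (by omega)).trans (le_of_eq ?_)
      congr 1
      omega
    linarith
  refine (Finset.sum_le_sum hrow).trans (le_of_eq ?_)
  simp

theorem eventually_measureReal_changeEvent_inter_le {W : Measure (ℝ≥0 → Bool)} (h : IsChainLaw W)
    {N i j : ℕ} (hij : i ≤ j) (hj : j < N) :
    ∀ᶠ n : ℕ in atTop, (outputLaw W n).real (changeEvent N i ∩ changeEvent N j) ≤
      160 / √(N : ℝ) * (1 / √(((j - i : ℕ) : ℝ) + 1)) := by
  have := h.isProb
  have hN : (0 : ℝ) < N := by exact_mod_cast (by omega : 0 < N)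
  have hsN : 0 < √(N : ℝ) := Real.sqrt_pos.2 hN
  rcases hij.eq_or_lt with rfl | hlt
  · refine Eventually.of_forall fun n => ?_
    rw [Set.inter_self]
    refine (measureReal_differAt_le_sqrt h n (grid_le N (Nat.le_succ i))).trans ?_
    rw [grid_succ_sub]
    have h1 : √(bitDiff (1 / N)) ≤ 1 / √(N : ℝ) := by
      rw [← Real.sqrt_one, ← Real.sqrt_div zero_le_one, Real.sqrt_one]
      refine Real.sqrt_le_sqrt ((bitDiff_le _).trans ?_)
      have : (0 : ℝ) < 1 / N := by positivity
      linarith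
    simp only [Nat.sub_self, Nat.cast_zero, zero_add, Real.sqrt_one, div_one, mul_one]
    refine (mul_le_mul_of_nonneg_left h1 (by norm_num)).trans ?_
    rw [mul_one_div]
    gcongr
    norm_num
  · have hN' : (0 : ℝ≥0) < N := by exact_mod_cast (by omega : 0 < N)
    have hd : ((j - i : ℕ) : ℝ) = (j : ℝ) - i := by
      rw [Nat.cast_sub hij]
    have hd1 : (1 : ℝ) ≤ ((j - i : ℕ) : ℝ) := by exact_mod_cast (by omega : 1 ≤ j - i)
    have hlt' : (i : ℝ≥0) / N < (j : ℝ≥0) / N := by gcongr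
    have hr1 : (((j : ℝ≥0) / N : ℝ≥0) : ℝ) - ((i : ℝ≥0) / N : ℝ≥0) ≤ 1 := by
      rw [grid_sub, div_le_one hN]
      have h1 : (j : ℝ) ≤ N := by exact_mod_cast hj.le
      have h2 : (0 : ℝ) ≤ i := Nat.cast_nonneg i
      linarith
    filter_upwards [eventually_measureReal_differAt_inter_le h
      (show (i : ℝ≥0) / N < ((i + 1 : ℕ) : ℝ≥0) / N by gcongr; simp)
      (grid_le N (Nat.le_succ j)) hlt' (grid_succ_sub N i) (grid_succ_sub N j) hr1] with n hn
    refine hn.trans ?_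
    rw [grid_sub, ← hd]
    generalize ((j - i : ℕ) : ℝ) = r at hd1
    have hr : 0 < √r := Real.sqrt_pos.2 (by linarith)
    have h1 : √(r + 1) ≤ 2 * √r := by
      rw [Real.sqrt_le_left (by positivity), mul_pow, Real.sq_sqrt (by linarith)]
      linarith
    have h2 : (N : ℝ) = √(N : ℝ) * √(N : ℝ) := (Real.mul_self_sqrt hN.le).symm
    have h3 : 80 * (1 / (N : ℝ)) / √(r / N) = 80 / √(N : ℝ) * (1 / √r) := by
      rw [Real.sqrt_div (by linarith)]
      conv_lhs => enter [1, 2, 2]; rw [h2]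
      field_simp
    have h4 : 1 / √r ≤ 2 * (1 / √(r + 1)) := by
      rw [mul_one_div, div_le_div_iff₀ hr (Real.sqrt_pos.2 (by linarith))]
      linarith
    rw [h3]
    calc 80 / √(N : ℝ) * (1 / √r) ≤ 80 / √(N : ℝ) * (2 * (1 / √(r + 1))) := by gcongr
      _ = 160 / √(N : ℝ) * (1 / √(r + 1)) := by ring

/-- The grid is fixed first and the depth sent to infinity afterwards, so finitely many asymptotic
bounds hold simultaneously. The lower bound does not depend on `M`. -/
theorem eventually_le_measureReal_lt_card_changeIndices {W : Measure (ℝ≥0 → Bool)}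
    (h : IsChainLaw W) (M : ℕ) : ∃ N : ℕ, ∀ᶠ n : ℕ in atTop,
      1 / 163840 ≤ (outputLaw W n).real {x | M < (changeIndices N x).card} := by
  have := h.isProb
  -- With N = R² the mean is at least R/8 and the second moment at most 640 R². This `R` makes `M`
  -- at most half the mean bound.
  obtain ⟨R, hR⟩ : ∃ R : ℕ, R = 16 * M + 1 := ⟨_, rfl⟩
  have hR0 : (0 : ℝ) < R := by rw [hR]; positivity
  have hMR : (M : ℝ) ≤ R / 16 := by rw [hR]; push_cast; linarith
  refine ⟨R ^ 2, ?_⟩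
  set N := R ^ 2 with hN
  have hN0 : 0 < N := by rw [hN, hR]; positivity
  have hNR : (N : ℝ) = (R : ℝ) ^ 2 := by rw [hN]; push_cast; rfl
  have hsN : √(N : ℝ) = R := by rw [hNR, Real.sqrt_sq hR0.le]
  have hfirst : ∀ᶠ n : ℕ in atTop, ∀ i ∈ Finset.range N,
      1 / (8 * (R : ℝ)) ≤ (outputLaw W n).real (changeEvent N i) := by
    rw [eventually_all_finset]
    intro i _
    have hN' : (0 : ℝ≥0) < N := by exact_mod_cast hN0
    have hN1 : (1 : ℝ) ≤ N := by exact_mod_cast hN0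
    filter_upwards [eventually_sqrt_le_measureReal_differAt h
      (show (i : ℝ≥0) / N < ((i + 1 : ℕ) : ℝ≥0) / N by gcongr; simp)
      (by rw [grid_succ_sub]; exact div_le_one_of_le₀ hN1 (by positivity))] with n hn
    rw [grid_succ_sub, Real.sqrt_div zero_le_one, Real.sqrt_one, hsN] at hn
    refine le_trans (le_of_eq ?_) hn
    field_simp
  have hsecond : ∀ᶠ n : ℕ in atTop, ∀ i ∈ Finset.range N, ∀ j ∈ Finset.range N, i ≤ j →
      (outputLaw W n).real (changeEvent N i ∩ changeEvent N j) ≤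
        160 / √(N : ℝ) * (1 / √(((j - i : ℕ) : ℝ) + 1)) := by
    rw [eventually_all_finset]
    intro i _
    rw [eventually_all_finset]
    intro j hj
    by_cases hij : i ≤ j
    · filter_upwards [eventually_measureReal_changeEvent_inter_le h hij (Finset.mem_range.1 hj)]
        with n hn _ using hn
    · exact Eventually.of_forall fun n hij' => absurd hij' hij
  filter_upwards [hfirst, hsecond] with n h1 h2
  have hL := isProbabilityMeasure_outputLaw W n
  have hsum1 : (R : ℝ) / 8 ≤ ∑ i ∈ Finset.range N, (outputLaw W n).real (changeEvent N i) := by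
    have := Finset.card_nsmul_le_sum _ _ _ h1
    rw [Finset.card_range, nsmul_eq_mul, hNR] at this
    refine le_trans (le_of_eq ?_) this
    field_simp
  have hsum2 : ∑ i ∈ Finset.range N, ∑ j ∈ Finset.range N,
      (outputLaw W n).real (changeEvent N i ∩ changeEvent N j) ≤ N * (2 * 320) := by
    refine sum_sum_le_of_le_dist (φ := fun d => 160 / √(N : ℝ) * (1 / √((d : ℝ) + 1)))
      ?_ ?_ ?_ ?_ ?_
    · intro a b hab
      dsimp only
      gcongr
    · intro d; positivity
    · intro i j
      rw [Set.inter_comm]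
    · intro i j hij hj
      exact h2 i (Finset.mem_range.2 (by omega)) j (Finset.mem_range.2 hj) hij
    · rw [← Finset.mul_sum]
      refine (mul_le_mul_of_nonneg_left (sum_one_div_sqrt_le N) (by positivity)).trans
        (le_of_eq ?_)
      rw [hsN]
      field_simp
      norm_num
  -- This `l` makes the second-moment term at most R/32, leaving R/8 - R/16 - R/32 = R/32 for the
  -- probability term.
  have hmain := first_moment_le_of_second_moment (outputLaw W n)
    (C := changeEvent N) (measurableSet_changeEvent N) N (M := (M : ℝ)) (Nat.cast_nonneg M)
    (l := 1 / (10240 * R)) (by positivity)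
  simp only [← card_changeIndices_eq_sum, Nat.cast_lt] at hmain
  set p := (outputLaw W n).real {x | M < (changeIndices N x).card}
  have hA : 1 / (10240 * (R : ℝ)) / 2 * ∑ i ∈ Finset.range N, ∑ j ∈ Finset.range N,
      (outputLaw W n).real (changeEvent N i ∩ changeEvent N j) ≤ R / 32 := by
    refine (mul_le_mul_of_nonneg_left hsum2 (by positivity)).trans (le_of_eq ?_)
    rw [hNR]
    field_simp
    norm_num
  have hB : 1 / (2 * (1 / (10240 * (R : ℝ)))) * p = R * (5120 * p) := by
    field_simp
    ring
  rw [hB] at hmain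
  have hfin : (R : ℝ) * (1 / 32) ≤ R * (5120 * p) := by linarith
  have := le_of_mul_le_mul_left hfin hR0
  linarith

/-! ### Few changes of a single gate -/

/-- The paths that differ at the times `0` and `1` and that, for arbitrarily large `N`, change at
most twice along the grid `i / N`. -/
def fewChanges : Set (ℝ≥0 → Bool) :=
  differAt 0 1 \ ⋃ m : ℕ, ⋂ N ∈ Set.Ioi m, {x | 2 < (changeIndices N x).card}

theorem measurableSet_manyChanges (m : ℕ) :
    MeasurableSet (⋂ N ∈ Set.Ioi m, {x : ℝ≥0 → Bool | 2 < (changeIndices N x).card}) :=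
  MeasurableSet.biInter (Set.to_countable _) fun N _ => measurableSet_lt_card_changeIndices N 2

theorem measurableSet_fewChanges : MeasurableSet fewChanges :=
  (measurableSet_differAt 0 1).diff (MeasurableSet.iUnion measurableSet_manyChanges)

/-- Markov's inequality at level 3, the mean number of changes being at most 1/2. -/
theorem IsChainLaw.measureReal_lt_card_changeIndices_le {W : Measure (ℝ≥0 → Bool)}
    (h : IsChainLaw W) {N : ℕ} (hN : 0 < N) :
    W.real {x | 2 < (changeIndices N x).card} ≤ 1 / 6 := by
  have := h.isProb
  have hint : ∀ i, Integrable ((changeEvent N i).indicator (1 : (ℝ≥0 → Bool) → ℝ)) W :=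
    fun i => (integrable_const (1 : ℝ)).indicator (measurableSet_changeEvent N i)
  have hsum : ∫ x, ((changeIndices N x).card : ℝ) ∂W ≤ 1 / 2 := by
    simp only [card_changeIndices_eq_sum]
    rw [integral_finsetSum _ fun i _ => hint i]
    have : ∀ i ∈ Finset.range N,
        ∫ x, (changeEvent N i).indicator (1 : (ℝ≥0 → Bool) → ℝ) x ∂W ≤ 1 / N / 2 := by
      intro i _
      rw [integral_indicator_one (measurableSet_changeEvent N i), changeEvent,
        h.measureReal_differAt (grid_le N (Nat.le_succ i)), grid_succ_sub]
      exact bitDiff_le _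
    refine (Finset.sum_le_sum this).trans (le_of_eq ?_)
    have hN' : (N : ℝ) ≠ 0 := by exact_mod_cast hN.ne'
    rw [Finset.sum_const, Finset.card_range, nsmul_eq_mul]
    field_simp
  have hmarkov := mul_meas_ge_le_integral_of_nonneg (μ := W)
    (f := fun x => ((changeIndices N x).card : ℝ)) (Eventually.of_forall fun x => Nat.cast_nonneg _)
    (by
      simp only [card_changeIndices_eq_sum]
      exact integrable_finsetSum _ fun i _ => hint i) 3
  have hset : {x : ℝ≥0 → Bool | 2 < (changeIndices N x).card} =
      {x | (3 : ℝ) ≤ ((changeIndices N x).card : ℝ)} := by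
    ext x
    simp only [Set.mem_ofPred_eq]
    rw [show (3 : ℝ) = ((3 : ℕ) : ℝ) by norm_num, Nat.cast_le]
    omega
  rw [hset]
  linarith

/-- Differing at 0 and 1 has probability at least 1/4, and 1/4 - 1/6 = 1/12. -/
theorem IsChainLaw.le_measureReal_fewChanges {W : Measure (ℝ≥0 → Bool)} (h : IsChainLaw W) :
    1 / 12 ≤ W.real fewChanges := by
  have := h.isProb
  have hmany : W.real (⋃ m : ℕ, ⋂ N ∈ Set.Ioi m, {x | 2 < (changeIndices N x).card}) ≤ 1 / 6 := by
    have ht := tendsto_measure_iUnion_atTop (μ := W)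
      (s := fun m : ℕ => ⋂ N ∈ Set.Ioi m, {x : ℝ≥0 → Bool | 2 < (changeIndices N x).card})
      (fun a b hab => Set.biInter_subset_biInter_left (Set.Ioi_subset_Ioi hab))
    have hle := le_of_tendsto' ht (b := ENNReal.ofReal (1 / 6)) fun m => by
      refine (measure_mono (Set.biInter_subset_of_mem (Set.mem_Ioi.2 (Nat.lt_succ_self m)))).trans ?_
      rw [← ofReal_measureReal]
      exact ENNReal.ofReal_le_ofReal (h.measureReal_lt_card_changeIndices_le (Nat.succ_pos m))
    rw [measureReal_def]
    exact ENNReal.toReal_le_of_le_ofReal (by norm_num) hle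
  have hdiff : 1 / 4 ≤ W.real (differAt 0 1) := by
    rw [h.measureReal_differAt zero_le]
    simpa using le_bitDiff (d := 1) zero_le_one le_rfl
  have := le_measureReal_sdiff (μ := W) (s₁ := differAt 0 1)
    (s₂ := ⋃ m : ℕ, ⋂ N ∈ Set.Ioi m, {x | 2 < (changeIndices N x).card})
  rw [fewChanges]
  linarith

theorem numChanges_of_mem_fewChanges {x : ℝ≥0 → Bool}
    (hx : ∀ t, ContinuousWithinAt x (Set.Ici t) t) (h : x ∈ fewChanges) :
    1 ≤ numChanges x 0 1 ∧ numChanges x 0 1 ≤ (2 : ℕ) := by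
  refine ⟨one_le_numChanges hx h.1, ?_⟩
  by_contra! hcon
  obtain ⟨m, hm⟩ := eventually_atTop.1 (eventually_lt_card_changeIndices hx hcon)
  refine h.2 (Set.mem_iUnion.2 ⟨m, Set.mem_iInter₂.2 fun N hN => hm N ?_⟩)
  exact le_of_lt hN

/-! ### The dynamical tree -/

theorem IsBitDynamics.ae_rightContinuous_andOr {Ω : Type*} [MeasurableSpace Ω] {μ : Measure Ω}
    {n : ℕ} {X : TreeVertex n → ℝ≥0 → Ω → Bool}
    (hX : IsBitDynamics (1 / 2) μ X) :
    ∀ᵐ ω ∂μ, ∀ t, ContinuousWithinAt (fun t => andOr n fun v => X v t ω) (Set.Ici t) t := by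
  filter_upwards [hX.rightContinuous] with ω hω t
  exact continuousWithinAt_andOr fun v => hω v t

/-- To bound the probability of an event from below, it suffices to consider right-continuous
out-signal paths. -/
theorem IsBitDynamics.le_measure_of_outputLaw {Ω : Type*} [MeasurableSpace Ω] {μ : Measure Ω}
    [IsProbabilityMeasure μ] {W : Measure (ℝ≥0 → Bool)} {n : ℕ} (hW : IsChainLaw W)
    {X : TreeVertex n → ℝ≥0 → Ω → Bool} (hX : IsBitDynamics (1 / 2) μ X) {ε : ℝ}
    {B : Set (ℝ≥0 → Bool)} (hB : MeasurableSet B) (hε : ε ≤ (outputLaw W n).real B) {E : Set Ω}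
    (hE : ∀ ω, (∀ t, ContinuousWithinAt (fun t => andOr n fun v => X v t ω) (Set.Ici t) t) →
      (fun t => andOr n fun v => X v t ω) ∈ B → ω ∈ E) :
    ENNReal.ofReal ε ≤ μ E := by
  have := hW.isProb
  have := isProbabilityMeasure_outputLaw W n
  have hm := measurable_andOr_path n X fun v => measurable_path hX v
  refine (ENNReal.ofReal_le_of_le_toReal hε).trans ?_
  rw [← hX.map_andOr hW, Measure.map_apply hm hB]
  refine measure_mono_ae ?_
  filter_upwards [hX.ae_rightContinuous_andOr] with ω hω hωB
  exact hE ω hω hωB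

/-- With the left child constantly 1 and the right one constantly 0, OR outputs 1 and AND outputs 0:
the root gate is reproduced. The three events are independent. -/
theorem IsBitDynamics.le_measure_one_le_changeCount_le_two {Ω : Type*} [MeasurableSpace Ω]
    {μ : Measure Ω} [IsProbabilityMeasure μ] {W : Measure (ℝ≥0 → Bool)} {n : ℕ} (hW : IsChainLaw W)
    {α : ℝ}
    (hα : 0 ≤ α) (hle : α ≤ (outputLaw W n).real onesOnDyadics)
    {X : TreeVertex (n + 1) → ℝ≥0 → Ω → Bool} (hX : IsBitDynamics (1 / 2) μ X) :
    ENNReal.ofReal (1 / 12 * (α * α)) ≤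
      μ {ω | 1 ≤ changeCount (andOr (n + 1)) X ω ∧
        changeCount (andOr (n + 1)) X ω ≤ ((2 : ℕ) : ℕ∞)} := by
  have := hW.isProb
  have := isProbabilityMeasure_outputLaw W n
  set B : Set ((ℝ≥0 → Bool) × (ℝ≥0 → Bool) × (ℝ≥0 → Bool)) :=
    fewChanges ×ˢ (onesOnDyadics ×ˢ (flipPath ⁻¹' onesOnDyadics)) with hB
  have hBm : MeasurableSet B := measurableSet_fewChanges.prod
    (measurableSet_onesOnDyadics.prod (measurable_flipPath measurableSet_onesOnDyadics))
  have hflip : (outputLaw W n).real (flipPath ⁻¹' onesOnDyadics) =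
      (outputLaw W n).real onesOnDyadics := by
    rw [← map_measureReal_apply measurable_flipPath measurableSet_onesOnDyadics,
      map_flipPath_outputLaw hW]
  have hBle : 1 / 12 * (α * α) ≤ (W.prod ((outputLaw W n).prod (outputLaw W n))).real B := by
    rw [hB, measureReal_prod_prod, measureReal_prod_prod, hflip]
    exact mul_le_mul hW.le_measureReal_fewChanges (mul_le_mul hle hle hα measureReal_nonneg)
      (by positivity) measureReal_nonneg
  refine (ENNReal.ofReal_le_of_le_toReal hBle).trans ?_
  rw [← hX.map_root_left_right_eq hW, Measure.map_apply ((measurable_path hX _).prodMk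
    ((measurable_andOr_path n (fun v => X v.left) fun v => measurable_path hX _).prodMk
      (measurable_andOr_path n (fun v => X v.right) fun v => measurable_path hX _))) hBm]
  refine measure_mono_ae ?_
  filter_upwards [hX.rightContinuous] with ω hω hωB
  have h1 := eqOn_true_of_mem_onesOnDyadics
    (fun t => continuousWithinAt_andOr (x := fun v t => X v.left t ω) fun v => hω _ t) hωB.2.1
  have h2 := eqOn_true_of_mem_onesOnDyadics
    (fun t => (continuous_of_discreteTopology
      (f := fun b : Bool => !b)).continuousAt.comp_continuousWithinAt
      (continuousWithinAt_andOr (x := fun v t => X v.right t ω) fun v => hω _ t)) hωB.2.2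
  have h3 : Set.EqOn (fun t => andOr (n + 1) fun v => X v t ω) (fun t => X .root t ω)
      (Set.Icc 0 1) := by
    intro t ht
    have e1 : (andOr n fun v => X v.left t ω) = true := h1 ht
    have e2 : (andOr n fun v => X v.right t ω) = false := by simpa using h2 ht
    simp only [andOr, e1, e2]
    cases X .root t ω <;> rfl
  change 1 ≤ numChanges _ 0 1 ∧ numChanges _ 0 1 ≤ _
  rw [numChanges_congr h3]
  exact numChanges_of_mem_fewChanges (hω .root) hωB.1

theorem theorem1p5 {Ω : ℕ → Type*} [∀ n, MeasurableSpace (Ω n)]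
    (μ : ∀ n, Measure (Ω n)) [∀ n, IsProbabilityMeasure (μ n)]
    (X : ∀ n, TreeVertex n → ℝ≥0 → Ω n → Bool)
    (hX : ∀ n, IsBitDynamics (1 / 2) (μ n) (X n)) :
    IsType2SemiVolatile μ (fun n => changeCount (andOr n) (X n)) ∧
    ∃ δ : ℝ, 0 < δ ∧ ∀ n,
      (μ n).real {ω | ∀ t ∈ Set.Icc (0 : ℝ≥0) 1, andOr n (fun v => X n v t ω) = true} ∈
        Set.Icc δ (1 - δ) := by
  -- By uniqueness, the law read off at depth 0 serves all depths.
  obtain ⟨W, hW⟩ : ∃ W, IsChainLaw W := ⟨_, (hX 0).isChainLaw .root⟩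
  have := hW.isProb
  obtain ⟨α, hα, hle⟩ := exists_le_measure_onesOnDyadics hW
  have hones : ∀ n, ENNReal.ofReal α ≤
      μ n {ω | ∀ t ∈ Set.Icc (0 : ℝ≥0) 1, andOr n (fun v => X n v t ω) = true} := fun n =>
    (hX n).le_measure_of_outputLaw hW measurableSet_onesOnDyadics (hle n) fun ω hω hωB =>
      eqOn_true_of_mem_onesOnDyadics hω hωB
  refine ⟨⟨⟨?_, ?_⟩, 2, one_le_two, ?_⟩, ?_⟩
  · refine (ENNReal.ofReal_pos.2 hα).trans_le (le_liminf_of_le (by isBoundedDefault)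
      (Eventually.of_forall fun n => (hones n).trans (measure_mono ?_)))
    intro ω hω
    change numChanges _ 0 1 = 0
    rw [numChanges_congr (y := fun _ => true) fun t ht => hω t ht]
    exact numChanges_const true 0 1
  · set F : ℕ → ℝ≥0∞ := fun M =>
      liminf (fun n => μ n {ω | (M : ℕ∞) < changeCount (andOr n) (X n) ω}) atTop
    have hanti : Antitone F := by
      intro M M' hMM'
      refine liminf_le_liminf (Eventually.of_forall fun n => measure_mono fun ω hω => ?_)
      exact lt_of_le_of_lt (by exact_mod_cast hMM') (show (M' : ℕ∞) < _ from hω)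
    refine ⟨⨅ M, F M, ?_, tendsto_atTop_iInf hanti⟩
    refine (ENNReal.ofReal_pos.2 (show (0 : ℝ) < 1 / 163840 by norm_num)).trans_le
      (le_iInf fun M => ?_)
    obtain ⟨N, hN⟩ := eventually_le_measureReal_lt_card_changeIndices hW M
    refine le_liminf_of_le (by isBoundedDefault) ?_
    filter_upwards [hN] with n hn
    refine (hX n).le_measure_of_outputLaw hW (measurableSet_lt_card_changeIndices N M) hn
      fun ω hω hωB => ?_
    exact lt_of_lt_of_le (by exact_mod_cast hωB) (card_changeIndices_le_numChanges hω N)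
  · refine (ENNReal.ofReal_pos.2 (show 0 < 1 / 12 * (α * α) by positivity)).trans_le
      (le_limsup_of_frequently_le (Eventually.frequently ?_) (by isBoundedDefault))
    filter_upwards [eventually_ge_atTop 1] with n hn
    obtain ⟨n, rfl⟩ := Nat.exists_eq_add_of_le' hn
    exact (hX (n + 1)).le_measure_one_le_changeCount_le_two hW hα.le (hle n)
  · refine ⟨α, hα, fun n => ?_⟩
    have := isProbabilityMeasure_outputLaw W n
    have hmem : MeasurableSet {w : ℝ≥0 → Bool | w 0 = true} :=
      (measurable_pi_apply 0 : Measurable fun w : ℝ≥0 → Bool => w 0) (measurableSet_singleton true)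
    have hlow : α ≤ (μ n).real
        {ω | ∀ t ∈ Set.Icc (0 : ℝ≥0) 1, andOr n (fun v => X n v t ω) = true} :=
      (ENNReal.ofReal_le_iff_le_toReal (measure_ne_top _ _)).1 (hones n)
    -- Together with `hlow` this forces α ≤ 1/2, so 1/2 ≤ 1 - α.
    have hhalf : (μ n).real
        {ω | ∀ t ∈ Set.Icc (0 : ℝ≥0) 1, andOr n (fun v => X n v t ω) = true} ≤ 1 / 2 := by
      rw [← measureReal_eval_true hW n 0, ← (hX n).map_andOr hW, map_measureReal_apply
        (measurable_andOr_path n (X n) fun v => measurable_path (hX n) v) hmem]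
      exact measureReal_mono fun ω hω => hω 0 ⟨le_rfl, zero_le⟩
    exact ⟨hlow, by linarith⟩
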